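/- Let $X=\{X(t)\}_{t\ge 0}$ be a real Lévy process on a probability space (that is, $X(0)=0$ a.s., $X$ has independent and stationary increments and a.s. càdlàg paths) with Lévy measure $\nu$: a measure on $\mathbb{R}_0=\mathbb{R}\setminus\{0\}$ with $\int_{\mathbb{R}_0}(1\wedge x^2)\,\nu(dx)<\infty$ such that, for some $\beta,\sigma\in\mathbb{R}$ and all $t\ge 0$, $u\in\mathbb{R}$, $$\mathbb{E}\big[e^{iuX(t)}\big]=\exp\Big\{t\Big(iu\beta-\tfrac{u^2\sigma^2}{2}+\int_{\mathbb{R}_0}\{e^{iux}-1-iux\mathbf 1_{\{|x|\le 1\}}\}\,\nu(dx)\Big)\Big\}.$$ Fix $T>0$. For $f:\mathbb{R}_0\to\mathbb{R}$, extended by $f(0)=0$, put $$I_n(f)=\sum_{k=1}^n f(\Delta_kX),\qquad \Delta_kX=X(kT/n)-X((k-1)T/n),$$ and, with $\Delta X(t)=X(t)-X(t^-)$ and $\mathcal J(B)=\#\{t>0:\Delta X(t)\ne 0,\ (t,\Delta X(t))\in B\}$ the jump measure of $X$, $$I(f)=\iint_{[0,T]\times\mathbb{R}_0}f(x)\,\mathcal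 J(dt,dx)=\sum_{t\le T}f(\Delta X(t)).$$ Suppose that $f$ satisfies one of the following two conditions: 1. $f=\mathbf 1_{(a,b]}h$ for an interval $[a,b]\subset\mathbb{R}_0$ with $\nu(\{a\})=\nu(\{b\})=0$ (automatic if $\nu$ has a density) and a function $h$ that is continuous on $[a,b]$; 2. $f$ is continuous on $\mathbb{R}_0$ and $\lim_{x\to 0}f(x)|x|^{-2}=0$. Then for every $u\in\mathbb{R}$ the function $e^{iuf}-1$ is $\nu$-integrable on $\mathbb{R}_0$ and $$\lim_{n\to\infty}\mathbb{E}\big[e^{iuI_n(f)}\big]=\exp\Big\{T\int_{\mathbb{R}_0}\big(e^{iuf(x)}-1\big)\,\nu(dx)\Big\}.$$ Moreover, $I(f)$ is almost surely well defined (the integral converges absolutely), and $I_n(f)$ converges in distribution to $I(f)$ as $n\to\infty$. -/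

import Mathlib

open MeasureTheory ProbabilityTheory Filter Topology
open scoped NNReal ENNReal

noncomputable section

namespace LevyDiscrete

/-- A path `x : [0, ∞) → ℝ` is càdlàg: right-continuous with finite left limits.
(At `t = 0` the left-limit clause is void.) -/
def IsCadlag (x : ℝ≥0 → ℝ) : Prop :=
  ∀ t : ℝ≥0, ContinuousWithinAt x (Set.Ioi t) t ∧ ∃ l : ℝ, Tendsto x (𝓝[<] t) (𝓝 l)

/-- A real Lévy process on `(Ω, P)`: it starts at `0` almost surely, has independent and stationary
increments, and has càdlàg paths almost surely. -/
structure IsLevyProcess {Ω : Type*} [MeasurableSpace Ω] (X : ℝ≥0 → Ω → ℝ) (P : Measure Ω) :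
    Prop where
  measurable : ∀ t, Measurable (X t)
  zero : ∀ᵐ ω ∂P, X 0 ω = 0
  indep : HasIndepIncrements X P
  stationary : ∀ s t : ℝ≥0, IdentDistrib (fun ω => X (s + t) ω - X s ω) (X t) P P
  cadlag : ∀ᵐ ω ∂P, IsCadlag (fun t => X t ω)

/-- A Lévy measure on `ℝ ∖ {0}`, regarded as a measure on `ℝ` without mass at `0`:
`∫ (1 ∧ x²) ν(dx) < ∞`. -/
structure IsLevyMeasure (ν : Measure ℝ) : Prop where
  zero : ν {0} = 0
  lintegral_lt_top : ∫⁻ x, ENNReal.ofReal (min 1 (x ^ 2)) ∂ν < ∞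

/-- The Lévy–Khintchine exponent with drift `b`, Gaussian coefficient `σ` and Lévy measure `ν`. -/
def levyExponent (b σ : ℝ) (ν : Measure ℝ) (u : ℝ) : ℂ :=
  Complex.I * u * b - (u : ℂ) ^ 2 * (σ : ℂ) ^ 2 / 2 +
    ∫ x in {0}ᶜ, (Complex.exp (Complex.I * u * x) - 1 -
      Complex.I * u * (Set.indicator {y : ℝ | |y| ≤ 1} (fun y => y) x : ℝ)) ∂ν

/-- `ν` is the Lévy measure of the process `X`: it is a Lévy measure and, for some `b` and `σ`,
`E[exp(i u X(t))] = exp(t ψ(u))` with `ψ` the Lévy–Khintchine exponent of `(b, σ, ν)`. -/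
def HasLevyMeasure {Ω : Type*} [MeasurableSpace Ω] (X : ℝ≥0 → Ω → ℝ) (P : Measure Ω)
    (ν : Measure ℝ) : Prop :=
  IsLevyMeasure ν ∧ ∃ b σ : ℝ, ∀ (t : ℝ≥0) (u : ℝ),
    ∫ ω, Complex.exp (Complex.I * u * X t ω) ∂P = Complex.exp ((t : ℝ) * levyExponent b σ ν u)

/-- The jump `Δx(t) = x(t) - x(t⁻)` of a path. -/
def jump (x : ℝ≥0 → ℝ) (t : ℝ≥0) : ℝ := x t - Function.leftLim x t

/-- The jump measure of a path on `[0, ∞) × (ℝ ∖ {0})`: the sum of the unit masses at the points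
`(t, Δx(t))` over the jump times `t > 0`, so that a Borel set `B` has mass
`#{t > 0 : Δx(t) ≠ 0, (t, Δx(t)) ∈ B}`. -/
def jumpMeasure (x : ℝ≥0 → ℝ) : Measure (ℝ≥0 × ℝ) :=
  Measure.sum fun t : {t : ℝ≥0 // 0 < t ∧ jump x t ≠ 0} => Measure.dirac (t.1, jump x t.1)

/-- The Poisson integral `I(f) = ∬_{[0,T] × (ℝ ∖ {0})} f(x) 𝒥(dt, dx)`. -/
def poissonIntegral {Ω : Type*} (X : ℝ≥0 → Ω → ℝ) (T : ℝ≥0) (f : ℝ → ℝ) (ω : Ω) : ℝ :=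
  ∫ p in Set.Icc 0 T ×ˢ {0}ᶜ, f p.2 ∂(jumpMeasure fun t => X t ω)

/-- The discrete statistic `I_n(f) = ∑_{k=1}^n f(X(kT/n) - X((k-1)T/n))`. -/
def discreteStat {Ω : Type*} (X : ℝ≥0 → Ω → ℝ) (T : ℝ≥0) (f : ℝ → ℝ) (n : ℕ) (ω : Ω) : ℝ :=
  ∑ k ∈ Finset.range n, f (X (((k : ℝ≥0) + 1) * (T / n)) ω - X ((k : ℝ≥0) * (T / n)) ω)

/-- First kind of integrand: `f = 1_{(a,b]} h` with `[a, b] ⊆ ℝ ∖ {0}`, `h` continuous, and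
endpoints that are not atoms of `ν` (automatic when `ν` has a density). -/
def IsWindowed (ν : Measure ℝ) (f : ℝ → ℝ) : Prop :=
  ∃ (a b : ℝ) (h : ℝ → ℝ), a ≤ b ∧ Set.Icc a b ⊆ {0}ᶜ ∧ ν {a} = 0 ∧ ν {b} = 0 ∧
    ContinuousOn h (Set.Icc a b) ∧ f = (Set.Ioc a b).indicator h

/-- Second kind of integrand: a continuous function on `ℝ ∖ {0}` with `f(x) = o(|x|²)` at `0`.
Such a function is extended by `f(0) = 0`, so that only actual increments and jumps count. -/
def IsSmallAtZero (f : ℝ → ℝ) : Prop :=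
  f 0 = 0 ∧ ContinuousOn f {0}ᶜ ∧ Tendsto (fun x => f x / |x| ^ 2) (𝓝[≠] 0) (𝓝 0)

end LevyDiscrete

end

/-! The analytic core is the small-time limit `t⁻¹ E[g(X_t)] → ∫ g dν` for bounded `g = o(x²)` at
`0` that is continuous off a closed `ν`-null set. It is obtained by Fourier analysis from the
Lévy–Khintchine formula alone. Let `w(x) = 1 - exp(-x²/2)`, which is comparable to `1 ∧ x²` and is
the average of `1 - e^{izx}` over a standard Gaussian `z`. The transform of `w` times the law of
`X_t` is therefore the Gaussian average of `e^{tψ(u)} - e^{tψ(u+z)}`. Divided by `t`, it tends to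
the average of `ψ(u) - ψ(u+z)` (`tendsto_inv_mul_integral_gaussWeight`), which is the transform of
the finite measure `(σ²/2) δ₀ + w ν` (`integral_levyExponent_sub`). The continuity theorem turns
this into weak convergence. Testing against `g / w`, which is bounded and vanishes continuously at
`0`, removes the Gaussian atom and gives `tendsto_inv_mul_integral`.

Characteristic functions: independent stationary increments give `E e^{iuI_n} = (1 + c_n)^n` with
`c_n = E[e^{iuf(X_{T/n})} - 1]`. The small-time limit gives `n c_n → T ∫ (e^{iuf} - 1) dν`, and the
power tends to the exponential.

Convergence in law is proved separately, through convergence in probability to `I(f)`. A càdlàg path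
has finitely many jumps above any threshold, and for an integrand vanishing near `0` the grid sums
converge path by path to the jump sum, provided no jump hits a discontinuity
(`IsCadlag.tendsto_sum_gridIncr`). Almost surely none does, because a non-atom of `ν` is not a jump
size (`ae_jump_ne`, by Fatou and shrinking tents). A general `f` differs from such an integrand by
`smallPart f δ`, which is at most `δ (1 ∧ y²)`. Its grid sums and its jump sum are uniformly small
in probability, by the bounded means in `exists_lintegral_jump_le` and Markov's inequality. -/

namespace LevyDiscrete

/-! ### Weak convergence of finite measures on the line. -/

open BoundedContinuousFunction

/-- The Lévy continuity theorem for finite measures. -/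
theorem tendsto_finiteMeasure_of_tendsto_charFun {μ : ℕ → FiniteMeasure ℝ} {μ₀ : FiniteMeasure ℝ}
    (h : ∀ u : ℝ, Tendsto (fun n => charFun (μ n : Measure ℝ) u) atTop
      (𝓝 (charFun (μ₀ : Measure ℝ) u))) :
    Tendsto μ atTop (𝓝 μ₀) := by
  have hmass' : ∀ m : FiniteMeasure ℝ, charFun (m : Measure ℝ) 0 = ((m.mass : ℝ) : ℂ) := fun m => by
    rw [charFun_zero]; rfl
  have hmass : Tendsto (fun n => (μ n).mass) atTop (𝓝 μ₀.mass) := by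
    have h0 := (Complex.continuous_re.tendsto _).comp (h 0)
    simp only [hmass', Complex.ofReal_re, Function.comp_def] at h0
    exact NNReal.tendsto_coe.1 h0
  -- Normalising divides by the mass of the limit, so a zero limit is settled by the masses alone.
  by_cases hz : μ₀ = 0
  · subst hz
    exact FiniteMeasure.tendsto_zero_of_tendsto_zero_mass (by simpa using hmass)
  have hz' : μ₀.mass ≠ 0 := by simpa using hz
  refine (FiniteMeasure.tendsto_normalize_iff_tendsto hz).1 ⟨?_, hmass⟩
  refine ProbabilityMeasure.tendsto_of_tendsto_charFun fun u => ?_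
  have hcf : ∀ m : FiniteMeasure ℝ, m ≠ 0 →
      charFun (m.normalize : Measure ℝ) u = ((m.mass : ℝ) : ℂ)⁻¹ * charFun (m : Measure ℝ) u := by
    intro m hm
    rw [FiniteMeasure.toMeasure_normalize_eq_of_nonzero _ hm, charFun_apply_real,
      charFun_apply_real, integral_smul_nnreal_measure, NNReal.smul_def, Complex.real_smul]
    simp
  rw [hcf _ hz]
  have hev : ∀ᶠ n in atTop, ((μ n).mass : ℝ≥0) ≠ 0 := hmass.eventually_ne hz'
  refine Tendsto.congr' (hev.mono fun n hn => (hcf _ (by simpa using hn)).symm) ?_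
  refine Tendsto.mul (Tendsto.inv₀ ?_ (by exact_mod_cast hz')) (h u)
  exact (Complex.continuous_ofReal.tendsto _).comp (NNReal.tendsto_coe.2 hmass)

/-- Weak convergence of finite measures passes to bounded integrands whose discontinuities lie in a
closed null set of the limit. -/
theorem tendsto_integral_of_continuousAt_compl {μ : ℕ → FiniteMeasure ℝ} {μ₀ : FiniteMeasure ℝ}
    (h : Tendsto μ atTop (𝓝 μ₀)) {q : ℝ → ℂ} (hq : Measurable q) {C : ℝ} (hC : ∀ x, ‖q x‖ ≤ C)
    {D : Set ℝ} (hD : IsClosed D) (hD0 : (μ₀ : Measure ℝ) D = 0)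
    (hcont : ∀ x ∉ D, ContinuousAt q x) :
    Tendsto (fun n => ∫ x, q x ∂(μ n : Measure ℝ)) atTop (𝓝 (∫ x, q x ∂(μ₀ : Measure ℝ))) := by
  have hC0 : 0 ≤ C := (norm_nonneg _).trans (hC 0)
  have h_integrable : ∀ m : FiniteMeasure ℝ, Integrable q (m : Measure ℝ) := fun m =>
    Integrable.of_bound hq.aestronglyMeasurable C (ae_of_all _ hC)
  let δ : ℕ → ℝ := fun j => 1 / ((j : ℝ) + 1)
  have hδ : ∀ j, 0 < δ j := fun j => by positivity
  let χ : ℕ → ℝ → ℝ := fun j x => (thickenedIndicator (hδ j) D x : ℝ)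
  have hχc : ∀ j, Continuous (χ j) := fun j =>
    NNReal.continuous_coe.comp (thickenedIndicator (hδ j) D).continuous
  have hχ1 : ∀ j x, χ j x ≤ 1 := fun j x => by
    exact_mod_cast thickenedIndicator_le_one (hδ j) D x
  have hχ0 : ∀ j x, 0 ≤ χ j x := fun j x => NNReal.coe_nonneg _
  have hχi : ∀ j (m : FiniteMeasure ℝ), Integrable (χ j) (m : Measure ℝ) := fun j m =>
    integrable_thickenedIndicator D (hδ j)
  have hlim : Tendsto (fun j => ∫ x, χ j x ∂(μ₀ : Measure ℝ)) atTop (𝓝 0) := by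
    have := tendsto_integral_thickenedIndicator_of_isClosed (μ₀ : Measure ℝ) hD hδ
      tendsto_one_div_add_atTop_nhds_zero_nat
    rw [Measure.real, hD0] at this
    exact this
  -- The factor `1 - χ j` tends to `0` at every point of `D` and `q` is bounded, so the product is
  -- continuous there too; off `D` both factors are.
  have hqχ : ∀ j, Continuous fun x => q x * ((1 - χ j x : ℝ) : ℂ) := by
    intro j
    rw [continuous_iff_continuousAt]
    intro x
    have hc : ContinuousAt (fun x => ((1 - χ j x : ℝ) : ℂ)) x :=
      (Complex.continuous_ofReal.comp (continuous_const.sub (hχc j))).continuousAt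
    by_cases hx : x ∈ D
    · have hx1 : χ j x = 1 := congrArg NNReal.toReal (thickenedIndicator_one (hδ j) D hx)
      have h0 : Tendsto (fun x => ((1 - χ j x : ℝ) : ℂ)) (𝓝 x) (𝓝 0) := by
        simpa [ContinuousAt, hx1] using hc
      have : Tendsto (fun y => q y * ((1 - χ j y : ℝ) : ℂ)) (𝓝 x) (𝓝 0) := by
        refine squeeze_zero_norm (a := fun y => C * ‖((1 - χ j y : ℝ) : ℂ)‖) (fun y => ?_) ?_
        · rw [norm_mul]
          gcongr
          exact hC y
        · simpa using (h0.norm.const_mul C)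
      simpa [ContinuousAt, hx1] using this
    · exact (hcont x hx).mul hc
  have hqχb : ∀ j x, ‖q x * ((1 - χ j x : ℝ) : ℂ)‖ ≤ C := by
    intro j x
    rw [norm_mul, Complex.norm_real, Real.norm_of_nonneg (by linarith [hχ1 j x])]
    nlinarith [hC x, hχ1 j x, hχ0 j x, norm_nonneg (q x)]
  have hdiff : ∀ j (m : FiniteMeasure ℝ),
      ‖∫ x, q x ∂(m : Measure ℝ) - ∫ x, q x * ((1 - χ j x : ℝ) : ℂ) ∂(m : Measure ℝ)‖ ≤
        C * ∫ x, χ j x ∂(m : Measure ℝ) := by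
    intro j m
    rw [← integral_sub (h_integrable m) (Integrable.of_bound (hqχ j).aestronglyMeasurable C
      (ae_of_all _ (hqχb j))), ← integral_const_mul]
    refine norm_integral_le_of_norm_le ((hχi j m).const_mul C) (ae_of_all _ fun x => ?_)
    have : q x - q x * ((1 - χ j x : ℝ) : ℂ) = q x * (χ j x : ℂ) := by push_cast; ring
    rw [this, norm_mul, Complex.norm_real, Real.norm_of_nonneg (hχ0 j x)]
    exact mul_le_mul_of_nonneg_right (hC x) (hχ0 j x)
  rw [Metric.tendsto_atTop']
  intro ε hε
  obtain ⟨j, hj⟩ : ∃ j, C * ∫ x, χ j x ∂(μ₀ : Measure ℝ) < ε / 3 := by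
    have : Tendsto (fun j => C * ∫ x, χ j x ∂(μ₀ : Measure ℝ)) atTop (𝓝 0) := by
      simpa using hlim.const_mul C
    exact (this.eventually (gt_mem_nhds (by positivity))).exists
  have hw := (FiniteMeasure.tendsto_iff_forall_integral_rclike_tendsto ℂ).1 h
    (BoundedContinuousFunction.ofNormedAddCommGroup _ (hqχ j) C (hqχb j))
  have hr := (FiniteMeasure.tendsto_iff_forall_integral_rclike_tendsto ℝ).1 h
    (BoundedContinuousFunction.ofNormedAddCommGroup (χ j) (hχc j) 1
      (fun x => by rw [Real.norm_of_nonneg (hχ0 j x)]; exact hχ1 j x))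
  simp only [BoundedContinuousFunction.coe_ofNormedAddCommGroup] at hw hr
  have h1 := (hr.const_mul C).eventually (gt_mem_nhds hj)
  have h2 := (Metric.tendsto_nhds.1 hw) (ε / 3) (by positivity)
  obtain ⟨N, hN⟩ := eventually_atTop.1 (h1.and h2)
  refine ⟨N, fun n hn => ?_⟩
  obtain ⟨h1, h2⟩ := hN n hn.le
  have d1 := hdiff j (μ n)
  have d2 := hdiff j μ₀
  rw [dist_eq_norm] at h2 ⊢
  rw [norm_sub_rev] at d2
  calc _ = ‖(∫ x, q x ∂(μ n : Measure ℝ) - ∫ x, q x * ((1 - χ j x : ℝ) : ℂ) ∂(μ n : Measure ℝ))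
        + (∫ x, q x * ((1 - χ j x : ℝ) : ℂ) ∂(μ n : Measure ℝ)
          - ∫ x, q x * ((1 - χ j x : ℝ) : ℂ) ∂(μ₀ : Measure ℝ))
        + (∫ x, q x * ((1 - χ j x : ℝ) : ℂ) ∂(μ₀ : Measure ℝ)
          - ∫ x, q x ∂(μ₀ : Measure ℝ))‖ := by congr 1; ring
    _ ≤ _ := norm_add₃_le
    _ < ε := by linarith

end LevyDiscrete

/-! ### The Lévy–Khintchine exponent and its Gaussian averages. -/

namespace LevyDiscrete

open Complex in
/-- The integrand of the Lévy–Khintchine formula. -/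
noncomputable def levyKernel (u x : ℝ) : ℂ :=
  exp (I * u * x) - 1 - I * u * (Set.indicator {y : ℝ | |y| ≤ 1} (fun y => y) x : ℝ)

/-- The bounded weight `1 - exp (-x² / 2)`, comparable to `1 ∧ x²`. -/
noncomputable def gaussWeight (x : ℝ) : ℝ := 1 - Real.exp (-x ^ 2 / 2)

theorem continuous_gaussWeight : Continuous gaussWeight := by
  unfold gaussWeight; fun_prop

theorem gaussWeight_zero : gaussWeight 0 = 0 := by simp [gaussWeight]

theorem gaussWeight_le (x : ℝ) : gaussWeight x ≤ min 1 (x ^ 2) := by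
  unfold gaussWeight
  refine le_min (by linarith [Real.exp_pos (-x ^ 2 / 2)]) ?_
  nlinarith [Real.add_one_le_exp (-x ^ 2 / 2), sq_nonneg x]

/-- From `e^{-y} ≤ 1/(1+y)` with `y = x²/2`, the weight is at least `y/(1+y)`; the constant 3 is
attained by this bound at `y = 1/2`, that is `x² = 1`. -/
theorem min_le_gaussWeight (x : ℝ) : min 1 (x ^ 2) ≤ 3 * gaussWeight x := by
  unfold gaussWeight
  set y := x ^ 2 / 2 with hy
  have hy0 : 0 ≤ y := by positivity
  have hE : -x ^ 2 / 2 = -y := by rw [hy]; ring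
  have h1 : Real.exp (-y) * (1 + y) ≤ 1 := by
    have := Real.add_one_le_exp y
    have h2 : Real.exp (-y) * Real.exp y = 1 := by rw [← Real.exp_add]; simp
    nlinarith [Real.exp_pos (-y)]
  rw [hE]
  have hp := Real.exp_pos (-y)
  rcases le_total (x ^ 2) 1 with h | h
  · rw [min_eq_right h]
    have : x ^ 2 = 2 * y := by rw [hy]; ring
    nlinarith
  · rw [min_eq_left h]
    have : (1 : ℝ) / 2 ≤ y := by rw [hy]; linarith
    nlinarith

theorem min_one_sq_nonneg (x : ℝ) : 0 ≤ min 1 (x ^ 2) := le_min zero_le_one (sq_nonneg x)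

theorem gaussWeight_nonneg (x : ℝ) : 0 ≤ gaussWeight x := by
  linarith [min_le_gaussWeight x, min_one_sq_nonneg x]

theorem gaussWeight_pos {x : ℝ} (hx : x ≠ 0) : 0 < gaussWeight x := by
  have : 0 < min 1 (x ^ 2) := lt_min one_pos (by positivity)
  linarith [min_le_gaussWeight x]

theorem measurable_min_one_sq : Measurable fun x : ℝ => min 1 (x ^ 2) := by fun_prop

namespace IsLevyMeasure

variable {ν : Measure ℝ} (hν : IsLevyMeasure ν)
include hν

theorem restrict_compl_zero : ν.restrict {0}ᶜ = ν :=
  Measure.restrict_eq_self_of_ae_mem (by rw [ae_iff]; simpa using hν.zero)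

theorem integrable_min : Integrable (fun x : ℝ => min 1 (x ^ 2)) ν := by
  refine ⟨measurable_min_one_sq.aestronglyMeasurable, ?_⟩
  rw [hasFiniteIntegral_iff_ofReal (ae_of_all _ min_one_sq_nonneg)]
  exact hν.lintegral_lt_top

theorem integrable_of_le {E : Type*} [NormedAddCommGroup E] {g : ℝ → E}
    (hg : AEStronglyMeasurable g ν) {K : ℝ} (h : ∀ x, ‖g x‖ ≤ K * min 1 (x ^ 2)) :
    Integrable g ν :=
  (hν.integrable_min.const_mul K).mono' hg (ae_of_all _ h)

/-- The density `1 ∧ x²` makes `ν` finite and is positive off the null point `0`, so it can be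
divided out again. Fubini for `ν` rests on this. -/
theorem sFinite : SFinite ν := by
  have hm : Measurable fun x : ℝ => ENNReal.ofReal (min 1 (x ^ 2)) :=
    measurable_min_one_sq.ennreal_ofReal
  have h0 : ∀ᵐ x ∂ν, ENNReal.ofReal (min 1 (x ^ 2)) ≠ 0 := by
    have : ∀ᵐ x ∂ν, x ≠ 0 := by rw [ae_iff]; simpa using hν.zero
    filter_upwards [this] with x hx
    have : 0 < min 1 (x ^ 2) := lt_min one_pos (by positivity)
    exact (ENNReal.ofReal_pos.2 this).ne'
  have := isFiniteMeasure_withDensity hν.lintegral_lt_top.ne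
  rw [← withDensity_inv_same hm h0 (ae_of_all _ fun _ => ENNReal.ofReal_ne_top)]
  infer_instance

end IsLevyMeasure

open Complex

theorem norm_exp_I_mul_real (u x : ℝ) : ‖exp (I * u * x)‖ = 1 := by
  rw [show I * (u : ℂ) * x = ((u * x : ℝ) : ℂ) * I by push_cast; ring]
  exact norm_exp_ofReal_mul_I _

theorem norm_exp_I_mul_sub_one_sub_le (y : ℝ) : ‖exp (I * y) - 1 - I * y‖ ≤ 3 * y ^ 2 := by
  have hn : ‖I * (y : ℂ)‖ = |y| := by simp
  rcases le_total |y| 1 with h | h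
  · have := norm_exp_sub_one_sub_id_le (x := I * y) (by rwa [hn])
    rw [hn, sq_abs] at this
    nlinarith [sq_nonneg y]
  · have h1 : ‖exp (I * y)‖ = 1 := by
      have := norm_exp_I_mul_real 1 y
      simpa only [ofReal_one, mul_one] using this
    calc ‖exp (I * y) - 1 - I * y‖ ≤ ‖exp (I * y)‖ + ‖(1 : ℂ)‖ + ‖I * (y : ℂ)‖ :=
          (norm_sub_le _ _).trans (add_le_add_left (norm_sub_le _ _) _)
      _ = 2 + |y| := by rw [h1, hn, norm_one]; ring
      _ ≤ 3 * y ^ 2 := by nlinarith [sq_abs y]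

theorem norm_levyKernel_le (u x : ℝ) : ‖levyKernel u x‖ ≤ (2 + 3 * u ^ 2) * min 1 (x ^ 2) := by
  unfold levyKernel
  by_cases hx : |x| ≤ 1
  · have hx2 : x ^ 2 ≤ 1 := by nlinarith [sq_abs x, abs_nonneg x]
    rw [Set.indicator_of_mem (by exact hx), min_eq_right hx2]
    have := norm_exp_I_mul_sub_one_sub_le (u * x)
    push_cast at this
    rw [← mul_assoc] at this
    nlinarith [sq_nonneg x]
  · have hx2 : 1 ≤ x ^ 2 := by nlinarith [sq_abs x, abs_nonneg x]
    rw [Set.indicator_of_notMem (by exact hx), min_eq_left hx2]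
    have := norm_sub_le (exp (I * u * x)) 1
    rw [norm_exp_I_mul_real, norm_one] at this
    simp only [ofReal_zero, mul_zero, sub_zero]
    nlinarith [sq_nonneg u]

theorem measurable_uncurry_levyKernel : Measurable (Function.uncurry levyKernel) := by
  have h1 : Measurable (Set.indicator {y : ℝ | |y| ≤ 1} (fun y => y)) :=
    measurable_id.indicator (measurableSet_le measurable_norm measurable_const)
  have h2 : Measurable fun p : ℝ × ℝ =>
    (Set.indicator {y : ℝ | |y| ≤ 1} (fun y => y) p.2 : ℝ) := h1.comp measurable_snd
  unfold levyKernel Function.uncurry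
  fun_prop

attribute [irreducible] levyKernel

theorem measurable_levyKernel (u : ℝ) : Measurable (levyKernel u) :=
  measurable_uncurry_levyKernel.of_uncurry_left

section Exponent

variable {ν : Measure ℝ} (hν : IsLevyMeasure ν) (b σ : ℝ)
include hν

theorem integrable_levyKernel (u : ℝ) : Integrable (levyKernel u) ν :=
  hν.integrable_of_le (measurable_levyKernel u).aestronglyMeasurable (norm_levyKernel_le u)

theorem levyExponent_eq (u : ℝ) : levyExponent b σ ν u =
    I * u * b - (u : ℂ) ^ 2 * (σ : ℂ) ^ 2 / 2 + ∫ x, levyKernel u x ∂ν := by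
  unfold levyExponent levyKernel
  rw [hν.restrict_compl_zero]

theorem measurable_levyExponent : Measurable (levyExponent b σ ν) := by
  have := hν.sFinite
  have h : Measurable fun u : ℝ => ∫ x, levyKernel u x ∂ν :=
    (StronglyMeasurable.integral_prod_right
      measurable_uncurry_levyKernel.stronglyMeasurable).measurable
  rw [show levyExponent b σ ν = fun u => _ from funext (levyExponent_eq hν b σ)]
  fun_prop

/-- Quadratic growth makes `z ↦ ψ(u + z)` integrable under a Gaussian and supplies the dominating
function below. -/
theorem exists_norm_levyExponent_le :
    ∃ K, ∀ u, ‖levyExponent b σ ν u‖ ≤ K * (1 + u ^ 2) := by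
  set M := ∫ x, min 1 (x ^ 2) ∂ν
  have hM : 0 ≤ M := integral_nonneg min_one_sq_nonneg
  refine ⟨|b| + σ ^ 2 + 3 * M, fun u => ?_⟩
  have hk : ‖∫ x, levyKernel u x ∂ν‖ ≤ (2 + 3 * u ^ 2) * M := by
    rw [← integral_const_mul]
    exact norm_integral_le_of_norm_le (hν.integrable_min.const_mul _)
      (ae_of_all _ (norm_levyKernel_le u))
  have h1 : ‖I * (u : ℂ) * b‖ = |u| * |b| := by simp
  have h2 : ‖(u : ℂ) ^ 2 * (σ : ℂ) ^ 2 / 2‖ = u ^ 2 * σ ^ 2 / 2 := by simp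
  have h3 : |u| ≤ 1 + u ^ 2 := by nlinarith [sq_abs u, sq_nonneg (|u| - 1)]
  rw [levyExponent_eq hν]
  calc _ ≤ ‖I * (u : ℂ) * b‖ + ‖(u : ℂ) ^ 2 * (σ : ℂ) ^ 2 / 2‖ + ‖∫ x, levyKernel u x ∂ν‖ :=
        (norm_add_le _ _).trans (add_le_add_left (norm_sub_le _ _) _)
    _ ≤ |u| * |b| + u ^ 2 * σ ^ 2 / 2 + (2 + 3 * u ^ 2) * M := by rw [h1, h2]; gcongr
    _ ≤ _ := by nlinarith [mul_le_mul_of_nonneg_right h3 (abs_nonneg b), sq_nonneg (u * σ),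
        sq_nonneg σ]

end Exponent

/-- The standard Gaussian law. -/
noncomputable abbrev stdGaussian : Measure ℝ := gaussianReal 0 1

theorem integrable_stdGaussian_sq : Integrable (fun z : ℝ => z ^ 2) stdGaussian := by
  simpa using (memLp_id_gaussianReal (μ := 0) (v := 1) 2).integrable_sq

theorem integrable_stdGaussian_id : Integrable (fun z : ℝ => z) stdGaussian := by
  exact (memLp_id_gaussianReal (μ := 0) (v := 1) 1).integrable (by simp)

theorem integral_stdGaussian_ofReal : ∫ z : ℝ, (z : ℂ) ∂stdGaussian = 0 := by
  rw [integral_complex_ofReal, integral_id_gaussianReal, ofReal_zero]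

theorem integral_stdGaussian_sq : ∫ z : ℝ, z ^ 2 ∂stdGaussian = 1 := by
  have h := variance_eq_integral (X := id) (μ := stdGaussian) aemeasurable_id
  rw [variance_id_gaussianReal] at h
  simpa using h.symm

theorem integral_stdGaussian_exp (x : ℝ) :
    ∫ z : ℝ, exp (I * z * x) ∂stdGaussian = (Real.exp (-x ^ 2 / 2) : ℂ) := by
  have := charFun_gaussianReal (μ := 0) (v := 1) x
  rw [charFun_apply_real] at this
  rw [show (fun z : ℝ => exp (I * z * x)) = fun z : ℝ => exp (x * z * I) by
    funext z; congr 1; ring, this]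
  push_cast
  congr 1
  simp
  ring

theorem integrable_exp_I_mul {μ : Measure ℝ} [IsFiniteMeasure μ] (u x : ℝ) :
    Integrable (fun z : ℝ => exp (I * ((u + z : ℝ) : ℂ) * x)) μ :=
  Integrable.of_bound (by fun_prop) 1 (ae_of_all _ fun z => (norm_exp_I_mul_real _ _).le)

theorem integral_stdGaussian_exp_add (u x : ℝ) :
    ∫ z : ℝ, exp (I * ((u + z : ℝ) : ℂ) * x) ∂stdGaussian =
      exp (I * u * x) * (Real.exp (-x ^ 2 / 2) : ℂ) := by
  rw [← integral_stdGaussian_exp, ← integral_const_mul]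
  congr 1 with z
  rw [← Complex.exp_add]
  congr 1
  push_cast
  ring

/-- The compensator is linear in `u`, so its increment is a multiple of `z` and averages to zero.
What remains is `e^{iux}` times one minus the Gaussian characteristic function at `x`. -/
theorem integral_levyKernel_sub (u x : ℝ) :
    ∫ z : ℝ, (levyKernel u x - levyKernel (u + z) x) ∂stdGaussian =
      exp (I * u * x) * (gaussWeight x : ℂ) := by
  set τ : ℝ := Set.indicator {y : ℝ | |y| ≤ 1} (fun y => y) x with hτ
  have e : (fun z : ℝ => levyKernel u x - levyKernel (u + z) x) = fun z : ℝ =>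
      (exp (I * u * x) - exp (I * ((u + z : ℝ) : ℂ) * x)) + I * τ * (z : ℂ) := by
    funext z
    unfold levyKernel
    simp only [← hτ]
    push_cast
    ring
  have hz : Integrable (fun z : ℝ => (z : ℂ)) stdGaussian := integrable_stdGaussian_id.ofReal
  have hd : Integrable (fun z : ℝ => exp (I * u * x) - exp (I * ((u + z : ℝ) : ℂ) * x))
      stdGaussian := (integrable_const _).sub (integrable_exp_I_mul u x)
  rw [e, integral_add hd (hz.const_mul _),
    integral_sub (integrable_const _) (integrable_exp_I_mul u x), integral_stdGaussian_exp_add,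
    integral_const_mul, integral_stdGaussian_ofReal]
  simp [gaussWeight]
  ring

/-- The drift contributes only a multiple of `z` and averages out, `E z² = 1` leaves `σ²/2` from the
Gaussian part, and Fubini handles the jump part. -/
theorem integral_levyExponent_sub {ν : Measure ℝ} (hν : IsLevyMeasure ν) (b σ u : ℝ) :
    ∫ z : ℝ, (levyExponent b σ ν u - levyExponent b σ ν (u + z)) ∂stdGaussian =
      (σ : ℂ) ^ 2 / 2 + ∫ x, exp (I * u * x) * (gaussWeight x : ℂ) ∂ν := by
  have := hν.sFinite
  have hz : Integrable (fun z : ℝ => (z : ℂ)) stdGaussian := integrable_stdGaussian_id.ofReal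
  have hz2 : Integrable (fun z : ℝ => (z : ℂ) ^ 2) stdGaussian := by
    simpa using integrable_stdGaussian_sq.ofReal (𝕜 := ℂ)
  have hz21 : ∫ z : ℝ, (z : ℂ) ^ 2 ∂stdGaussian = 1 := by
    have := integral_ofReal (𝕜 := ℂ) (f := fun z : ℝ => z ^ 2) (μ := stdGaussian)
    rw [integral_stdGaussian_sq] at this
    simpa using this
  have e : (fun z : ℝ => levyExponent b σ ν u - levyExponent b σ ν (u + z)) = fun z : ℝ =>
      ((-I * b + u * σ ^ 2) * (z : ℂ) + ((σ : ℂ) ^ 2 / 2) * (z : ℂ) ^ 2) +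
        ∫ x, (levyKernel u x - levyKernel (u + z) x) ∂ν := by
    funext z
    rw [levyExponent_eq hν, levyExponent_eq hν,
      integral_sub (integrable_levyKernel hν u) (integrable_levyKernel hν (u + z))]
    push_cast
    ring
  have hprod : Integrable (Function.uncurry fun z x => levyKernel u x - levyKernel (u + z) x)
      (stdGaussian.prod ν) := by
    have hb : Integrable (fun z : ℝ => 4 + 3 * u ^ 2 + 3 * (u + z) ^ 2) stdGaussian := by
      have : (fun z : ℝ => 4 + 3 * u ^ 2 + 3 * (u + z) ^ 2) =
          fun z => (4 + 6 * u ^ 2) + 6 * u * z + 3 * z ^ 2 := by funext z; ring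
      rw [this]
      exact ((integrable_const _).add (integrable_stdGaussian_id.const_mul _)).add
        (integrable_stdGaussian_sq.const_mul _)
    refine (hb.mul_prod hν.integrable_min).mono' ?_ (ae_of_all _ fun p => ?_)
    · have h1 : Measurable fun p : ℝ × ℝ => levyKernel u p.2 :=
        (measurable_levyKernel u).comp measurable_snd
      have h2 : Measurable fun p : ℝ × ℝ => levyKernel (u + p.1) p.2 :=
        measurable_uncurry_levyKernel.comp
          (by fun_prop : Measurable fun p : ℝ × ℝ => (u + p.1, p.2))
      exact (h1.sub h2).aestronglyMeasurable
    · refine (norm_sub_le _ _).trans ((add_le_add (norm_levyKernel_le _ _)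
        (norm_levyKernel_le _ _)).trans_eq ?_)
      ring
  have hd : Integrable (fun z : ℝ => (-I * b + u * σ ^ 2) * (z : ℂ) +
      ((σ : ℂ) ^ 2 / 2) * (z : ℂ) ^ 2) stdGaussian := (hz.const_mul _).add (hz2.const_mul _)
  have hi : Integrable (fun z => ∫ x, (levyKernel u x - levyKernel (u + z) x) ∂ν) stdGaussian :=
    hprod.integral_prod_left
  rw [e, integral_add hd hi,
    integral_add (hz.const_mul _) (hz2.const_mul _), integral_const_mul, integral_const_mul,
    integral_stdGaussian_ofReal,
    hz21, integral_integral_swap hprod]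
  simp only [integral_levyKernel_sub]
  ring

/-- Mean value inequality on the convex half-plane `re ≤ 0`, where the derivative of `exp` has norm
at most `1`. -/
theorem norm_exp_sub_exp_le {a c : ℂ} (ha : a.re ≤ 0) (hc : c.re ≤ 0) :
    ‖exp a - exp c‖ ≤ ‖a - c‖ := by
  have := Convex.norm_image_sub_le_of_norm_hasDerivWithin_le (f := exp) (f' := exp)
    (s := {z : ℂ | z.re ≤ 0}) (C := 1) (x := c) (y := a)
    (fun z _ => (hasDerivAt_exp z).hasDerivWithinAt)
    (fun z hz => by rw [norm_exp]; exact Real.exp_le_one_iff.2 hz)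
    (convex_halfSpace_re_le 0) hc ha
  simpa using this

theorem tendsto_inv_mul_exp_sub_exp {t : ℕ → ℝ} (ht : ∀ n, 0 < t n)
    (ht0 : Tendsto t atTop (𝓝 0)) (a c : ℂ) :
    Tendsto (fun n => ((t n)⁻¹ : ℂ) * (exp (t n * a) - exp (t n * c))) atTop (𝓝 (a - c)) := by
  have hd : HasDerivAt (fun s : ℝ => exp (s * a) - exp (s * c)) (a - c) 0 := by
    have h (a : ℂ) : HasDerivAt (fun s : ℝ => exp (s * a)) a 0 := by
      have h1 : HasDerivAt (fun s : ℝ => (s : ℂ) * a) a 0 := by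
        simpa using (ofRealCLM.hasDerivAt (x := (0 : ℝ))).mul_const a
      simpa using h1.cexp
    exact (h a).sub (h c)
  have hw : Tendsto t atTop (𝓝[≠] 0) :=
    tendsto_nhdsWithin_iff.2 ⟨ht0, Eventually.of_forall fun n => (ht n).ne'⟩
  simpa [Function.comp_def] using hd.tendsto_slope_zero.comp hw

/-! ### Small-time limit of the weighted laws. -/

section SmallTime

variable {ν : Measure ℝ} (hν : IsLevyMeasure ν) {b σ : ℝ} {t : ℕ → ℝ} (ht : ∀ n, 0 < t n)
  (ht0 : Tendsto t atTop (𝓝 0)) {L : ℕ → Measure ℝ} [∀ n, IsProbabilityMeasure (L n)]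
  (hL : ∀ n (u : ℝ), ∫ x, exp (I * u * x) ∂(L n) = exp (t n * levyExponent b σ ν u))

include ht hL in
theorem levyExponent_re_nonpos (u : ℝ) : (levyExponent b σ ν u).re ≤ 0 := by
  have h1 : ‖exp (t 0 * levyExponent b σ ν u)‖ ≤ 1 := by
    rw [← hL 0 u]
    simpa using norm_integral_le_of_norm_le_const (μ := L 0) (C := 1)
      (ae_of_all _ fun x => (norm_exp_I_mul_real u x).le)
  rw [norm_exp, Real.exp_le_one_iff, re_ofReal_mul] at h1
  exact nonpos_of_mul_nonpos_right h1 (ht 0)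

include hL in
theorem integral_exp_mul_gaussWeight (n : ℕ) (u : ℝ) :
    ∫ x, exp (I * u * x) * (gaussWeight x : ℂ) ∂(L n) =
      ∫ z : ℝ, (exp (t n * levyExponent b σ ν u) - exp (t n * levyExponent b σ ν (u + z)))
        ∂stdGaussian := by
  have h_integrable : Integrable (Function.uncurry fun x z : ℝ =>
      exp (I * u * x) - exp (I * ((u + z : ℝ) : ℂ) * x)) ((L n).prod stdGaussian) := by
    refine Integrable.of_bound (C := 2) ?_ (ae_of_all _ fun p => ?_)
    · unfold Function.uncurry
      fun_prop
    · refine (norm_sub_le _ _).trans ?_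
      rw [norm_exp_I_mul_real, norm_exp_I_mul_real]
      norm_num
  have e : ∀ x : ℝ, exp (I * u * x) * (gaussWeight x : ℂ) =
      ∫ z : ℝ, (exp (I * u * x) - exp (I * ((u + z : ℝ) : ℂ) * x)) ∂stdGaussian := by
    intro x
    rw [integral_sub (integrable_const _) (integrable_exp_I_mul u x),
      integral_stdGaussian_exp_add]
    simp [gaussWeight]
    ring
  have hi (v : ℝ) : Integrable (fun x : ℝ => exp (I * v * x)) (L n) :=
    Integrable.of_bound (by fun_prop) 1 (ae_of_all _ fun x => (norm_exp_I_mul_real _ _).le)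
  simp only [e]
  rw [integral_integral_swap h_integrable]
  congr 1 with z
  rw [integral_sub (hi u) (hi (u + z)), hL, hL]

include hν ht ht0 hL in
-- Dominated convergence in `z`: the integrand is a difference quotient at `0`, and the 1-Lipschitz
-- bound for `exp` keeps it below `|ψ(u)| + |ψ(u+z)|`, whose growth in `z` is quadratic.
theorem tendsto_inv_mul_integral_gaussWeight (u : ℝ) :
    Tendsto (fun n => ((t n)⁻¹ : ℂ) * ∫ x, exp (I * u * x) * (gaussWeight x : ℂ) ∂(L n)) atTop
      (𝓝 ((σ : ℂ) ^ 2 / 2 + ∫ x, exp (I * u * x) * (gaussWeight x : ℂ) ∂ν)) := by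
  rw [← integral_levyExponent_sub hν b]
  simp only [integral_exp_mul_gaussWeight hL, ← integral_const_mul]
  have hre := levyExponent_re_nonpos (ν := ν) ht hL
  have hm := measurable_levyExponent hν b σ
  have hm' : Measurable fun z => levyExponent b σ ν (u + z) :=
    hm.comp (measurable_const.add measurable_id)
  obtain ⟨K, hK⟩ := exists_norm_levyExponent_le hν b σ
  refine tendsto_integral_of_dominated_convergence
    (fun z => K * (1 + u ^ 2) + K * (1 + (u + z) ^ 2)) ?_ ?_ ?_ ?_
  · intro n
    exact Measurable.aestronglyMeasurable (by fun_prop)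
  · have : (fun z : ℝ => K * (1 + u ^ 2) + K * (1 + (u + z) ^ 2)) =
        fun z => K * (2 + 2 * u ^ 2) + 2 * K * u * z + K * z ^ 2 := by funext z; ring
    rw [this]
    exact ((integrable_const _).add (integrable_stdGaussian_id.const_mul _)).add
      (integrable_stdGaussian_sq.const_mul _)
  · intro n
    refine ae_of_all _ fun z => ?_
    have hle := norm_exp_sub_exp_le (a := t n * levyExponent b σ ν u)
      (c := t n * levyExponent b σ ν (u + z))
      (by rw [re_ofReal_mul]; exact mul_nonpos_of_nonneg_of_nonpos (ht n).le (hre u))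
      (by rw [re_ofReal_mul]; exact mul_nonpos_of_nonneg_of_nonpos (ht n).le (hre _))
    rw [← mul_sub, norm_mul, norm_real, Real.norm_of_nonneg (ht n).le] at hle
    rw [norm_mul, norm_inv, norm_real, Real.norm_of_nonneg (ht n).le,
      inv_mul_le_iff₀ (ht n)]
    refine hle.trans (mul_le_mul_of_nonneg_left ?_ (ht n).le)
    exact (norm_sub_le _ _).trans (add_le_add (hK _) (hK _))
  · exact ae_of_all _ fun z => tendsto_inv_mul_exp_sub_exp ht ht0 _ _

end SmallTime

end LevyDiscrete

/-! ### Small-time asymptotics for test functions that are `o(x²)` at the origin. -/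

namespace LevyDiscrete

open Complex Asymptotics

theorem exists_norm_le_mul_min {E : Type*} [NormedAddCommGroup E] {g : ℝ → E} {C : ℝ}
    (hC : ∀ x, ‖g x‖ ≤ C) (ho : g =o[𝓝 0] fun x : ℝ => x ^ 2) :
    ∃ K, 0 ≤ K ∧ ∀ x, ‖g x‖ ≤ K * min 1 (x ^ 2) := by
  obtain ⟨δ, hδ, h⟩ := Metric.eventually_nhds_iff.1 (ho.bound one_pos)
  have hC0 : 0 ≤ C := (norm_nonneg _).trans (hC 0)
  -- `e` is a lower bound for `1 ∧ x²` where the little-o estimate is not available; there `C / e`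
  -- suffices.
  set e := min 1 (δ ^ 2) with he
  have he0 : 0 < e := lt_min one_pos (by positivity)
  have hCe : 0 ≤ C / e := by positivity
  refine ⟨C / e + 1 + C, by positivity, fun x => ?_⟩
  have hm := min_one_sq_nonneg x
  by_cases hx : |x| < δ
  · have h1 := h (y := x) (by simpa [Real.dist_eq] using hx)
    rw [norm_pow, Real.norm_eq_abs, sq_abs, one_mul] at h1
    rcases le_total 1 (x ^ 2) with h2 | h2
    · rw [min_eq_left h2]; linarith [hC x]
    · rw [min_eq_right h2] at hm ⊢; nlinarith
  · have h2 : e ≤ min 1 (x ^ 2) := by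
      refine le_min (min_le_left _ _) ((min_le_right _ _).trans ?_)
      rw [← sq_abs x]
      exact pow_le_pow_left₀ hδ.le (not_lt.1 hx) 2
    have : C ≤ C / e * min 1 (x ^ 2) := by
      calc C = C / e * e := by field_simp
        _ ≤ _ := by gcongr
    nlinarith [hC x]

theorem integral_withDensity_gaussWeight (M : Measure ℝ) {c : ℝ} (hc : 0 ≤ c) (q : ℝ → ℂ) :
    ∫ x, q x ∂(M.withDensity fun x => ENNReal.ofReal (c * gaussWeight x)) =
      c * ∫ x, q x * (gaussWeight x : ℂ) ∂M := by
  rw [integral_withDensity_eq_integral_toReal_smul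
    (continuous_gaussWeight.measurable.const_mul c).ennreal_ofReal
    (ae_of_all _ fun _ => ENNReal.ofReal_lt_top), ← integral_const_mul]
  congr 1 with x
  rw [ENNReal.toReal_ofReal (mul_nonneg hc (gaussWeight_nonneg x)), real_smul]
  push_cast
  ring

theorem isFiniteMeasure_withDensity_gaussWeight {M : Measure ℝ}
    (hM : Integrable gaussWeight M) (c : ℝ) :
    IsFiniteMeasure (M.withDensity fun x => ENNReal.ofReal (c * gaussWeight x)) :=
  isFiniteMeasure_withDensity_ofReal (hM.const_mul c).2

theorem gaussWeight_le_one (x : ℝ) : gaussWeight x ≤ 1 := (gaussWeight_le x).trans (min_le_left _ _)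

theorem integrable_gaussWeight (M : Measure ℝ) [IsFiniteMeasure M] : Integrable gaussWeight M :=
  Integrable.of_bound continuous_gaussWeight.aestronglyMeasurable 1 (ae_of_all _ fun x => by
    rw [Real.norm_of_nonneg (gaussWeight_nonneg x)]; exact gaussWeight_le_one x)

theorem IsLevyMeasure.integrable_gaussWeight {ν : Measure ℝ} (hν : IsLevyMeasure ν) :
    Integrable gaussWeight ν :=
  hν.integrable_of_le (K := 1) continuous_gaussWeight.aestronglyMeasurable fun x => by
    rw [Real.norm_of_nonneg (gaussWeight_nonneg x), one_mul]; exact gaussWeight_le x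

section SmallTime

variable {ν : Measure ℝ} (hν : IsLevyMeasure ν) {b σ : ℝ} {t : ℕ → ℝ} (ht : ∀ n, 0 < t n)
  (ht0 : Tendsto t atTop (𝓝 0)) {L : ℕ → Measure ℝ} [∀ n, IsProbabilityMeasure (L n)]
  (hL : ∀ n (u : ℝ), ∫ x, exp (I * u * x) ∂(L n) = exp (t n * levyExponent b σ ν u))
include hν ht ht0 hL

/-- Small-time asymptotics of an infinitely divisible semigroup: `t⁻¹ E[g(X_t)] → ∫ g dν` for
bounded `g` with `g(x) = o(x²)` at `0` that is continuous off a closed `ν`-null set. -/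
theorem tendsto_inv_mul_integral {g : ℝ → ℂ} (hg : Measurable g) {C : ℝ} (hC : ∀ x, ‖g x‖ ≤ C)
    (ho : g =o[𝓝 0] fun x : ℝ => x ^ 2) {D : Set ℝ} (hD : IsClosed D) (hD0 : (0 : ℝ) ∉ D)
    (hDν : ν D = 0) (hcont : ∀ x ∉ D, x ≠ 0 → ContinuousAt g x) :
    Tendsto (fun n => ((t n)⁻¹ : ℂ) * ∫ x, g x ∂(L n)) atTop (𝓝 (∫ x, g x ∂ν)) := by
  have hg0 : g 0 = 0 := by
    have := (ho.bound one_pos).self_of_nhds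
    simpa using this
  have hinv : ∀ n, 0 ≤ (t n)⁻¹ := fun n => (inv_pos.2 (ht n)).le
  let μ : ℕ → FiniteMeasure ℝ := fun n =>
    ⟨(L n).withDensity fun x => ENNReal.ofReal ((t n)⁻¹ * gaussWeight x),
      isFiniteMeasure_withDensity_gaussWeight (integrable_gaussWeight (L n)) _⟩
  have hfin := isFiniteMeasure_withDensity_gaussWeight hν.integrable_gaussWeight 1
  -- Since `w(x) ~ x²/2` at `0`, the Gaussian component survives in the limit as an atom of mass
  -- `σ²/2`.
  let m₀ : Measure ℝ := ENNReal.ofReal (σ ^ 2 / 2) • Measure.dirac 0 +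
    ν.withDensity fun x => ENNReal.ofReal (1 * gaussWeight x)
  have hfin0 : IsFiniteMeasure (ENNReal.ofReal (σ ^ 2 / 2) • Measure.dirac (0 : ℝ)) :=
    Measure.smul_finite _ ENNReal.ofReal_ne_top
  have hfin' : IsFiniteMeasure m₀ := by infer_instance
  let μ₀ : FiniteMeasure ℝ := ⟨m₀, hfin'⟩
  have hμ : ∀ n (q : ℝ → ℂ), ∫ x, q x ∂(μ n : Measure ℝ) =
      ((t n)⁻¹ : ℂ) * ∫ x, q x * (gaussWeight x : ℂ) ∂(L n) := fun n q => by
    rw [← ofReal_inv]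
    exact integral_withDensity_gaussWeight (L n) (hinv n) q
  have hμ₀ : ∀ q : ℝ → ℂ, Measurable q → (∃ K, ∀ x, ‖q x‖ ≤ K) → ∫ x, q x ∂(μ₀ : Measure ℝ) =
      (σ : ℂ) ^ 2 / 2 * q 0 + ∫ x, q x * (gaussWeight x : ℂ) ∂ν := by
    rintro q hq ⟨K, hK⟩
    have hi : ∀ M : Measure ℝ, IsFiniteMeasure M → Integrable q M := fun M _ =>
      Integrable.of_bound hq.aestronglyMeasurable K (ae_of_all _ hK)
    change ∫ x, q x ∂m₀ = _
    rw [integral_add_measure (hi _ hfin0) (hi _ hfin), integral_smul_measure, integral_dirac,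
      integral_withDensity_gaussWeight ν zero_le_one, ENNReal.toReal_ofReal (by positivity)]
    simp
  have hconv : Tendsto μ atTop (𝓝 μ₀) := by
    refine tendsto_finiteMeasure_of_tendsto_charFun fun u => ?_
    have e : ∀ x : ℝ, exp (u * x * I) = exp (I * u * x) := fun x => by congr 1; ring
    simp only [charFun_apply_real, e]
    rw [hμ₀ _ (by fun_prop) ⟨1, fun x => (norm_exp_I_mul_real u x).le⟩]
    simp only [hμ]
    simpa using tendsto_inv_mul_integral_gaussWeight hν ht ht0 hL u
  -- Here `q 0 = 0` by the convention for division by zero. This agrees with the limit at `0`, and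
  -- so the atom of `m₀` contributes nothing.
  let q : ℝ → ℂ := fun x => g x / (gaussWeight x : ℂ)
  have hqm : Measurable q :=
    hg.div (continuous_ofReal.measurable.comp continuous_gaussWeight.measurable)
  have hq0 : q 0 = 0 := by simp [q, hg0]
  have hqw : ∀ x, q x * (gaussWeight x : ℂ) = g x := by
    intro x
    by_cases hx : x = 0
    · simp [hx, hg0, gaussWeight_zero]
    · have : (gaussWeight x : ℂ) ≠ 0 := by exact_mod_cast (gaussWeight_pos hx).ne'
      simp only [q]
      field_simp
  obtain ⟨K, hK0, hK⟩ := exists_norm_le_mul_min hC ho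
  have hqn : ∀ x, ‖q x‖ = ‖g x‖ / gaussWeight x := fun x => by
    simp only [q, norm_div, norm_real, Real.norm_of_nonneg (gaussWeight_nonneg x)]
  have hqb : ∀ x, ‖q x‖ ≤ 3 * K := by
    intro x
    by_cases hx : x = 0
    · rw [hx, hq0, norm_zero]; positivity
    · rw [hqn, div_le_iff₀ (gaussWeight_pos hx)]
      nlinarith [hK x, min_le_gaussWeight x]
  have hqc : ∀ x ∉ D, ContinuousAt q x := by
    intro x hx
    by_cases hx0 : x = 0
    · subst hx0
      rw [ContinuousAt, hq0, Metric.tendsto_nhds]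
      intro ε hε
      -- Near `0` one has `x² ≤ 3 w(x)`, so `|g| ≤ (ε/4) x²` gives `|q| ≤ 3ε/4 < ε`.
      filter_upwards [ho.bound (show 0 < ε / 4 by positivity),
        Metric.ball_mem_nhds (0 : ℝ) one_pos] with x h1 h2
      rw [dist_zero_right]
      by_cases hx : x = 0
      · rw [hx, hq0, norm_zero]; exact hε
      · have hx1 : |x| < 1 := by simpa [Real.dist_eq] using h2
        have hx2 : x ^ 2 ≤ 1 := by nlinarith [sq_abs x, abs_nonneg x]
        rw [norm_pow, Real.norm_eq_abs, sq_abs] at h1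
        have h3 := min_le_gaussWeight x
        rw [min_eq_right hx2] at h3
        rw [hqn, div_lt_iff₀ (gaussWeight_pos hx)]
        nlinarith [gaussWeight_pos hx]
    · refine (hcont x hx hx0).div
        (continuous_ofReal.comp continuous_gaussWeight).continuousAt ?_
      exact_mod_cast (gaussWeight_pos hx0).ne'
  have hD' : (μ₀ : Measure ℝ) D = 0 := by
    change m₀ D = 0
    simp only [m₀, Measure.add_apply, Measure.smul_apply, Measure.dirac_apply' _ hD.measurableSet,
      Set.indicator_of_notMem hD0, smul_zero, zero_add]
    exact withDensity_absolutelyContinuous _ _ hDν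
  have := tendsto_integral_of_continuousAt_compl hconv hqm hqb hD hD' hqc
  rw [hμ₀ q hqm ⟨_, hqb⟩, hq0] at this
  simpa only [hμ, hqw, mul_zero, zero_add] using this

theorem tendsto_inv_mul_integral_real {g : ℝ → ℝ} (hg : Continuous g) {C : ℝ}
    (hC : ∀ x, ‖g x‖ ≤ C) (ho : g =o[𝓝 0] fun x : ℝ => x ^ 2) :
    Tendsto (fun n => (t n)⁻¹ * ∫ x, g x ∂(L n)) atTop (𝓝 (∫ x, g x ∂ν)) := by
  have := tendsto_inv_mul_integral hν ht ht0 hL (g := fun x => (g x : ℂ)) (C := C) (D := ∅)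
    (continuous_ofReal.comp hg).measurable (fun x => by rw [norm_real]; exact hC x)
    (ho.norm_left.congr_left fun x => (norm_real _).symm).of_norm_left isClosed_empty
    (by simp) (by simp)
    (fun x _ _ => (continuous_ofReal.comp hg).continuousAt)
  simp only [integral_complex_ofReal] at this
  have h2 := (continuous_re.tendsto _).comp this
  simpa [Function.comp_def, ← ofReal_inv, ← ofReal_mul] using h2

/-- The function `1 ∧ x²` is not `o(x²)`, so the limit theorem does not apply to it. The total
masses of the weighted laws (the case `u = 0`) converge, hence are bounded, and dominate it up to
the factor 3. -/
theorem exists_inv_mul_integral_min_le :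
    ∃ C, ∀ n, (t n)⁻¹ * ∫ x, min 1 (x ^ 2) ∂(L n) ≤ C := by
  have h := tendsto_inv_mul_integral_gaussWeight hν ht ht0 hL 0
  simp only [ofReal_zero, mul_zero, zero_mul, exp_zero, one_mul, integral_complex_ofReal] at h
  have h2 := (continuous_re.tendsto _).comp h
  obtain ⟨C, hC⟩ := h2.bddAbove_range
  refine ⟨3 * C, fun n => ?_⟩
  have h3 : (t n)⁻¹ * ∫ x, gaussWeight x ∂(L n) ≤ C := by
    have := hC ⟨n, rfl⟩
    simpa [← ofReal_inv, ← ofReal_mul] using this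
  have h4 : ∫ x, min 1 (x ^ 2) ∂(L n) ≤ 3 * ∫ x, gaussWeight x ∂(L n) := by
    rw [← integral_const_mul]
    refine integral_mono ?_ ((integrable_gaussWeight (L n)).const_mul 3) min_le_gaussWeight
    exact Integrable.of_bound measurable_min_one_sq.aestronglyMeasurable 1 (ae_of_all _ fun x => by
      rw [Real.norm_of_nonneg (min_one_sq_nonneg x)]; exact min_le_left _ _)
  have := mul_le_mul_of_nonneg_left h4 (inv_pos.2 (ht n)).le
  linarith

end SmallTime

end LevyDiscrete

/-! ### Regular grids and càdlàg paths. -/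

namespace LevyDiscrete

/-- The `k`-th increment of a path over the regular grid of mesh `T / n`. -/
noncomputable def gridIncr (x : ℝ≥0 → ℝ) (T : ℝ≥0) (n k : ℕ) : ℝ :=
  x (((k : ℝ≥0) + 1) * (T / n)) - x ((k : ℝ≥0) * (T / n))

/-- The index `k` of the grid cell `(k T / n, (k + 1) T / n]` containing `τ > 0`. -/
noncomputable def gridIndex (T : ℝ≥0) (n : ℕ) (τ : ℝ≥0) : ℕ := ⌈τ / (T / n)⌉₊ - 1

section Grid

variable {T τ : ℝ≥0}

theorem gridIndex_mul_lt (hT : 0 < T) {n : ℕ} (hn : 0 < n) (hτ : 0 < τ) :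
    (gridIndex T n τ : ℝ≥0) * (T / n) < τ := by
  have hm : 0 < T / n := div_pos hT (by exact_mod_cast hn)
  rw [← lt_div_iff₀ hm]
  have h1 : 0 < ⌈τ / (T / n)⌉₊ := Nat.ceil_pos.2 (div_pos hτ hm)
  exact Nat.lt_ceil.1 (by unfold gridIndex; omega)

theorem le_gridIndex_add_one_mul (hT : 0 < T) {n : ℕ} (hn : 0 < n) :
    τ ≤ ((gridIndex T n τ : ℝ≥0) + 1) * (T / n) := by
  have hm : 0 < T / n := div_pos hT (by exact_mod_cast hn)
  rw [← div_le_iff₀ hm]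
  refine (Nat.le_ceil _).trans ?_
  exact_mod_cast (by unfold gridIndex; omega : ⌈τ / (T / n)⌉₊ ≤ gridIndex T n τ + 1)

theorem gridIndex_lt (hT : 0 < T) {n : ℕ} (hn : 0 < n) (hτ : 0 < τ) (hτT : τ ≤ T) :
    gridIndex T n τ < n := by
  have hm : 0 < T / n := div_pos hT (by exact_mod_cast hn)
  have hn' : (n : ℝ≥0) ≠ 0 := by exact_mod_cast hn.ne'
  have h := (gridIndex_mul_lt hT hn hτ).trans_le hτT
  rw [← lt_div_iff₀ hm] at h
  have e : T / (T / n) = n := by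
    have := hT.ne'
    field_simp
  rw [e] at h
  exact_mod_cast h

theorem gridIndex_eq (hT : 0 < T) {n k : ℕ} (hn : 0 < n)
    (h : τ ∈ Set.Ioc ((k : ℝ≥0) * (T / n)) (((k : ℝ≥0) + 1) * (T / n))) : gridIndex T n τ = k := by
  have hm : 0 < T / n := div_pos hT (by exact_mod_cast hn)
  have h1 : k < ⌈τ / (T / n)⌉₊ := Nat.lt_ceil.2 ((lt_div_iff₀ hm).2 h.1)
  have h2 : ⌈τ / (T / n)⌉₊ ≤ k + 1 := Nat.ceil_le.2 (by
    push_cast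
    exact (div_le_iff₀ hm).2 h.2)
  unfold gridIndex
  omega

theorem tendsto_mesh (T : ℝ≥0) : Tendsto (fun n : ℕ => T / (n : ℝ≥0)) atTop (𝓝 0) :=
  NNReal.tendsto_coe.1 (by simpa using tendsto_const_div_atTop_nhds_zero_nat (T : ℝ))

/-- The cell of `τ` is open on the left and closed on the right, so its left end approaches strictly
from below and sees `x(τ⁻)`, while its right end sees `x(τ)`. -/
theorem tendsto_grid_left (hT : 0 < T) (hτ : 0 < τ) :
    Tendsto (fun n : ℕ => (gridIndex T n τ : ℝ≥0) * (T / n)) atTop (𝓝[<] τ) := by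
  refine tendsto_nhdsWithin_iff.2 ⟨?_, ?_⟩
  · have h : Tendsto (fun n : ℕ => τ - T / (n : ℝ≥0)) atTop (𝓝 τ) := by
      simpa using tendsto_const_nhds.sub (tendsto_mesh T)
    refine tendsto_of_tendsto_of_tendsto_of_le_of_le' h tendsto_const_nhds ?_ ?_
    · filter_upwards [eventually_gt_atTop 0] with n hn
      rw [tsub_le_iff_right]
      have := le_gridIndex_add_one_mul (τ := τ) hT hn
      rwa [add_mul, one_mul] at this
    · filter_upwards [eventually_gt_atTop 0] with n hn
      exact (gridIndex_mul_lt hT hn hτ).le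
  · filter_upwards [eventually_gt_atTop 0] with n hn
    exact gridIndex_mul_lt hT hn hτ

theorem tendsto_grid_right (hT : 0 < T) (hτ : 0 < τ) :
    Tendsto (fun n : ℕ => ((gridIndex T n τ : ℝ≥0) + 1) * (T / n)) atTop (𝓝[≥] τ) := by
  refine tendsto_nhdsWithin_iff.2 ⟨?_, ?_⟩
  · have h := ((tendsto_grid_left hT hτ).mono_right nhdsWithin_le_nhds).add (tendsto_mesh T)
    simpa [add_mul] using h
  · filter_upwards [eventually_gt_atTop 0] with n hn
    exact le_gridIndex_add_one_mul hT hn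

theorem eventually_injOn_gridIndex (hT : 0 < T) (F : Finset ℝ≥0) (hF : ∀ τ ∈ F, 0 < τ) :
    ∀ᶠ n : ℕ in atTop, Set.InjOn (gridIndex T n) F := by
  have key : ∀ τ ∈ F, ∀ τ' ∈ F, ∀ᶠ n : ℕ in atTop, τ < τ' → gridIndex T n τ ≠ gridIndex T n τ' := by
    intro τ hτ τ' hτ'
    by_cases hlt : τ < τ'
    · have h := (tendsto_mesh T).eventually (gt_mem_nhds (tsub_pos_of_lt hlt))
      filter_upwards [h, eventually_gt_atTop 0] with n h1 hn _ heq
      have h2 := gridIndex_mul_lt hT hn (hF τ hτ)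
      have h3 := le_gridIndex_add_one_mul (τ := τ') hT hn
      rw [← heq, add_mul, one_mul] at h3
      have h4 : T / n + τ < τ' := lt_tsub_iff_right.1 h1
      exact absurd (h3.trans (add_le_add_left h2.le _)) (not_le.2 (by rwa [add_comm]))
    · exact Eventually.of_forall fun n h => absurd h hlt
  have key' := (Finset.eventually_all F).2 fun τ hτ => (Finset.eventually_all F).2 (key τ hτ)
  filter_upwards [key'] with n hn τ hτ τ' hτ' heq
  by_contra hne
  rcases lt_or_gt_of_ne hne with h | h
  · exact hn τ hτ τ' hτ' h heq
  · exact hn τ' hτ' τ hτ h heq.symm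

end Grid

section Path

variable {x : ℝ≥0 → ℝ} (hx : IsCadlag x) {T : ℝ≥0}
include hx

theorem IsCadlag.tendsto_leftLim (t : ℝ≥0) :
    Tendsto x (𝓝[<] t) (𝓝 (Function.leftLim x t)) :=
  tendsto_leftLim_of_tendsto (hx t).2

theorem IsCadlag.tendsto_right (t : ℝ≥0) : Tendsto x (𝓝[≥] t) (𝓝 (x t)) :=
  continuousWithinAt_Ioi_iff_Ici.1 (hx t).1

theorem IsCadlag.tendsto_gridIncr (hT : 0 < T) {τ : ℝ≥0} (hτ : 0 < τ) :
    Tendsto (fun n => gridIncr x T n (gridIndex T n τ)) atTop (𝓝 (jump x τ)) :=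
  ((hx.tendsto_right τ).comp (tendsto_grid_right hT hτ)).sub
    ((hx.tendsto_leftLim τ).comp (tendsto_grid_left hT hτ))

/-- Around each time `t`, the increments of a càdlàg path are small unless they straddle `t`, in
which case they are close to the jump at `t`. -/
theorem IsCadlag.eventually_incr (t : ℝ≥0) {η : ℝ} (hη : 0 < η) :
    ∃ U : Set ℝ≥0, IsOpen U ∧ t ∈ U ∧ ∀ r ∈ U, ∀ s ∈ U, r < s →
      (t ∉ Set.Ioc r s → |x s - x r| < η) ∧ (t ∈ Set.Ioc r s → |x s - x r - jump x t| < η) := by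
  have h1 := eventually_nhdsWithin_iff.1
    (Metric.tendsto_nhds.1 (hx.tendsto_leftLim t) (η / 2) (by positivity))
  have h2 := eventually_nhdsWithin_iff.1
    (Metric.tendsto_nhds.1 (hx.tendsto_right t) (η / 2) (by positivity))
  obtain ⟨U, hU, hUo, htU⟩ := eventually_nhds_iff.1 (h1.and h2)
  refine ⟨U, hUo, htU, fun r hr s hs hrs => ⟨fun hn => ?_, fun hm => ?_⟩⟩
  · rcases lt_or_ge s t with hst | hst
    · have a := (hU r hr).1 (hrs.trans hst)
      have b := (hU s hs).1 hst
      rw [Real.dist_eq, abs_lt] at a b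
      rw [abs_lt]
      constructor <;> linarith [a.1, a.2, b.1, b.2]
    · have hrt : t ≤ r := by
        by_contra h
        exact hn ⟨not_le.1 h, hst⟩
      have a := (hU r hr).2 hrt
      have b := (hU s hs).2 hst
      rw [Real.dist_eq, abs_lt] at a b
      rw [abs_lt]
      constructor <;> linarith [a.1, a.2, b.1, b.2]
  · have a := (hU r hr).1 hm.1
    have b := (hU s hs).2 hm.2
    rw [Real.dist_eq, abs_lt] at a b
    rw [abs_lt, jump]
    constructor <;> linarith [a.1, a.2, b.1, b.2]

theorem IsCadlag.exists_forall_incr (T : ℝ≥0) {η : ℝ} (hη : 0 < η) :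
    ∃ δ > 0, ∀ r s : ℝ≥0, r < s → s ≤ T → dist s r < δ →
      |x s - x r| < η ∨ ∃ t ∈ Set.Ioc r s, |x s - x r - jump x t| < η := by
  choose U hUo htU hU using fun t => hx.eventually_incr t hη
  obtain ⟨δ, hδ, h⟩ := lebesgue_number_lemma_of_metric (isCompact_Icc (a := (0 : ℝ≥0)) (b := T))
    hUo (fun t _ => Set.mem_iUnion.2 ⟨t, htU t⟩)
  refine ⟨δ, hδ, fun r s hrs hsT hd => ?_⟩
  obtain ⟨t, ht⟩ := h r ⟨zero_le, hrs.le.trans hsT⟩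
  have h1 := hU t r (ht (Metric.mem_ball_self hδ)) s (ht hd) hrs
  by_cases hm : t ∈ Set.Ioc r s
  · exact Or.inr ⟨t, hm, h1.2 hm⟩
  · exact Or.inl (h1.1 hm)

/-- In the neighbourhood of `t` given by `eventually_incr`, a jump at any `t' ≠ t` is a limit of
increments not straddling `t`, hence at most `ε/2`. By compactness finitely many such neighbourhoods
cover `[0, T]`, and only their centres can jump by `ε`. -/
theorem IsCadlag.finite_setOf_le_abs_jump (T : ℝ≥0) {ε : ℝ} (hε : 0 < ε) :
    {t | t ∈ Set.Ioc 0 T ∧ ε ≤ |jump x t|}.Finite := by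
  choose U hUo htU hU using fun t => hx.eventually_incr t (half_pos hε)
  obtain ⟨F, -, hF⟩ := (isCompact_Icc (a := (0 : ℝ≥0)) (b := T)).elim_nhds_subcover U
    fun t _ => (hUo t).mem_nhds (htU t)
  refine F.finite_toSet.subset fun t' ⟨⟨ht0, htT⟩, hj⟩ => ?_
  obtain ⟨t, htF, htt⟩ := Set.mem_iUnion₂.1 (hF ⟨zero_le, htT⟩)
  suffices t' = t from this ▸ htF
  by_contra hne
  have hneBot : (𝓝[<] t').NeBot := nhdsLT_neBot_of_exists_lt ⟨0, ht0⟩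
  have hev : ∀ᶠ r in 𝓝[<] t', |x t' - x r| ≤ ε / 2 := by
    have h1 : ∀ᶠ r in 𝓝[<] t', r ∈ U t := mem_nhdsWithin_of_mem_nhds ((hUo t).mem_nhds htt)
    have h2 : ∀ᶠ r in 𝓝[<] t', t ∉ Set.Ioc r t' := by
      rcases lt_or_gt_of_ne hne with h | h
      · exact Eventually.of_forall fun r hr => absurd hr.2 (not_le.2 h)
      · filter_upwards [mem_nhdsWithin_of_mem_nhds (Ioi_mem_nhds h)] with r hr hm
        exact absurd hm.1 (not_lt.2 (le_of_lt hr))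
    filter_upwards [h1, h2, self_mem_nhdsWithin] with r hr hm hlt
    exact ((hU t r hr t' htt hlt).1 hm).le
  have hlim : |jump x t'| ≤ ε / 2 :=
    le_of_tendsto (tendsto_const_nhds.sub (hx.tendsto_leftLim t')).abs hev
  linarith

omit hx in
theorem sum_gridIndex_le_sum (hT : 0 < T) {g : ℝ → ℝ} (hg : ∀ y, 0 ≤ g y) {F : Finset ℝ≥0}
    (hF : ∀ τ ∈ F, τ ∈ Set.Ioc 0 T) {n : ℕ} (hn : 0 < n) (hinj : Set.InjOn (gridIndex T n) F) :
    ∑ τ ∈ F, g (gridIncr x T n (gridIndex T n τ)) ≤ ∑ k ∈ Finset.range n, g (gridIncr x T n k) := by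
  classical
  rw [← Finset.sum_image (f := fun k => g (gridIncr x T n k)) hinj]
  refine Finset.sum_le_sum_of_subset_of_nonneg (fun k hk => ?_) fun _ _ _ => hg _
  obtain ⟨τ, hτ, rfl⟩ := Finset.mem_image.1 hk
  exact Finset.mem_range.2 (gridIndex_lt hT hn (hF τ hτ).1 (hF τ hτ).2)

/-- Finite sums over jumps are dominated in the limit by the sums over grid increments. -/
theorem IsCadlag.sum_jump_le_liminf (hT : 0 < T) {g : ℝ → ℝ} (hg : ∀ y, 0 ≤ g y)
    (hgc : Continuous g) {F : Finset ℝ≥0} (hF : ∀ τ ∈ F, τ ∈ Set.Ioc 0 T) :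
    ENNReal.ofReal (∑ τ ∈ F, g (jump x τ)) ≤
      liminf (fun n => ENNReal.ofReal (∑ k ∈ Finset.range n, g (gridIncr x T n k))) atTop := by
  have hlim : Tendsto (fun n => ENNReal.ofReal
      (∑ τ ∈ F, g (gridIncr x T n (gridIndex T n τ)))) atTop
      (𝓝 (ENNReal.ofReal (∑ τ ∈ F, g (jump x τ)))) :=
    (ENNReal.continuous_ofReal.tendsto _).comp (tendsto_finsetSum _ fun τ hτ =>
      (hgc.tendsto _).comp (hx.tendsto_gridIncr hT (hF τ hτ).1))
  rw [← hlim.liminf_eq]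
  refine liminf_le_liminf ?_
  filter_upwards [eventually_gt_atTop 0,
    eventually_injOn_gridIndex hT F fun τ hτ => (hF τ hτ).1] with n hn hinj
  exact ENNReal.ofReal_le_ofReal (sum_gridIndex_le_sum hT hg hF hn hinj)

/-- For a function vanishing near `0` and continuous at the jumps of the path, the sums over grid
increments converge to the sum over the jumps. -/
theorem IsCadlag.tendsto_sum_gridIncr (hT : 0 < T) {f : ℝ → ℝ} {ε : ℝ}
    (hf : ∀ y, |y| < ε → f y = 0) {F : Finset ℝ≥0} (hF : ∀ τ ∈ F, τ ∈ Set.Ioc 0 T)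
    (hFε : ∀ τ ∈ Set.Ioc 0 T, ε / 2 ≤ |jump x τ| → τ ∈ F) (hε : 0 < ε)
    (hc : ∀ τ ∈ F, ContinuousAt f (jump x τ)) :
    Tendsto (fun n => ∑ k ∈ Finset.range n, f (gridIncr x T n k)) atTop
      (𝓝 (∑ τ ∈ F, f (jump x τ))) := by
  classical
  have hlim : Tendsto (fun n => ∑ τ ∈ F, f (gridIncr x T n (gridIndex T n τ))) atTop
      (𝓝 (∑ τ ∈ F, f (jump x τ))) :=
    tendsto_finsetSum _ fun τ hτ => (hc τ hτ).tendsto.comp (hx.tendsto_gridIncr hT (hF τ hτ).1)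
  refine hlim.congr' ?_
  obtain ⟨δ, hδ, hosc⟩ := hx.exists_forall_incr T (half_pos hε)
  have hmesh : ∀ᶠ n : ℕ in atTop, ((T / (n : ℝ≥0) : ℝ≥0) : ℝ) < δ :=
    (NNReal.tendsto_coe.2 (tendsto_mesh T)).eventually (gt_mem_nhds hδ)
  filter_upwards [eventually_gt_atTop 0, hmesh,
    eventually_injOn_gridIndex hT F fun τ hτ => (hF τ hτ).1] with n hn hm hinj
  rw [← Finset.sum_image (f := fun k => f (gridIncr x T n k)) hinj]
  refine Finset.sum_subset (fun k hk => ?_) fun k hk hkF => ?_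
  · obtain ⟨τ, hτ, rfl⟩ := Finset.mem_image.1 hk
    exact Finset.mem_range.2 (gridIndex_lt hT hn (hF τ hτ).1 (hF τ hτ).2)
  · have hmp : 0 < T / (n : ℝ≥0) := div_pos hT (by exact_mod_cast hn)
    have hn0 : (n : ℝ≥0) ≠ 0 := by exact_mod_cast hn.ne'
    have hkn : (k : ℝ≥0) + 1 ≤ n := by exact_mod_cast Finset.mem_range.1 hk
    have hsT : ((k : ℝ≥0) + 1) * (T / n) ≤ T := by
      calc ((k : ℝ≥0) + 1) * (T / n) ≤ n * (T / n) := by gcongr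
        _ = T := by field_simp
    have hd : dist (((k : ℝ≥0) + 1) * (T / n)) ((k : ℝ≥0) * (T / n)) < δ := by
      rw [add_mul, one_mul, NNReal.dist_eq, NNReal.coe_add, add_sub_cancel_left,
        abs_of_nonneg (NNReal.coe_nonneg _)]
      exact hm
    have hlt : (k : ℝ≥0) * (T / n) < ((k : ℝ≥0) + 1) * (T / n) := by
      rw [add_mul, one_mul]
      exact lt_add_of_pos_right _ hmp
    -- A cell containing no point of `F` has an increment within `ε/2` of either zero or a jump
    -- smaller than `ε/2`, so `f` vanishes on it.
    refine hf _ ?_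
    rcases hosc _ _ hlt hsT hd with h | ⟨t, ht, h⟩
    · exact h.trans (by linarith)
    · have htF : t ∉ F := fun htF =>
        hkF (Finset.mem_image.2 ⟨t, htF, gridIndex_eq hT hn ht⟩)
      have hj : |jump x t| < ε / 2 := by
        by_contra hcon
        exact htF (hFε t ⟨zero_le.trans_lt ht.1, ht.2.trans hsT⟩ (not_lt.1 hcon))
      rw [abs_lt] at h hj
      rw [gridIncr, abs_lt]
      constructor <;> linarith [h.1, h.2, hj.1, hj.2]

end Path

end LevyDiscrete

/-! ### Integrals against the jump measure, and truncation near zero. -/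

namespace LevyDiscrete

section JumpMeasure

variable {x : ℝ≥0 → ℝ} {T : ℝ≥0}

theorem restrict_jumpMeasure (x : ℝ≥0 → ℝ) (T : ℝ≥0) :
    (jumpMeasure x).restrict (Set.Icc 0 T ×ˢ {0}ᶜ) =
      Measure.sum fun t : {t : ℝ≥0 // 0 < t ∧ jump x t ≠ 0} =>
        if t.1 ≤ T then Measure.dirac (t.1, jump x t.1) else 0 := by
  classical
  have hs : MeasurableSet (Set.Icc (0 : ℝ≥0) T ×ˢ ({0}ᶜ : Set ℝ)) :=
    measurableSet_Icc.prod (measurableSet_singleton 0).compl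
  rw [jumpMeasure, Measure.restrict_sum _ hs]
  congr 1 with t : 1
  rw [restrict_dirac' hs]
  have : ((t.1, jump x t.1) ∈ Set.Icc (0 : ℝ≥0) T ×ˢ ({0}ᶜ : Set ℝ)) ↔ t.1 ≤ T := by
    simp [t.2.2]
  simp only [this]

theorem lintegral_jumpMeasure {g : ℝ → ℝ≥0∞} (hg : Measurable g) :
    ∫⁻ p in Set.Icc 0 T ×ˢ {0}ᶜ, g p.2 ∂(jumpMeasure x) =
      ∑' t : {t : ℝ≥0 // 0 < t ∧ jump x t ≠ 0}, if t.1 ≤ T then g (jump x t.1) else 0 := by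
  rw [restrict_jumpMeasure, lintegral_sum_measure]
  congr 1 with t
  split_ifs
  · exact lintegral_dirac' _ (hg.comp measurable_snd)
  · simp

theorem integral_jumpMeasure {f : ℝ → ℝ}
    (hi : IntegrableOn (fun p : ℝ≥0 × ℝ => f p.2) (Set.Icc 0 T ×ˢ {0}ᶜ) (jumpMeasure x)) :
    ∫ p in Set.Icc 0 T ×ˢ {0}ᶜ, f p.2 ∂(jumpMeasure x) =
      ∑' t : {t : ℝ≥0 // 0 < t ∧ jump x t ≠ 0}, if t.1 ≤ T then f (jump x t.1) else 0 := by
  rw [IntegrableOn, restrict_jumpMeasure] at hi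
  rw [restrict_jumpMeasure, integral_sum_measure hi]
  congr 1 with t
  split_ifs
  · rw [integral_dirac]
  · simp

/-- A sum over all jumps up to time `T` reduces to a finite sum when only finitely many jumps
contribute. -/
theorem tsum_jump_eq_sum {α : Type*} [AddCommMonoid α] [TopologicalSpace α] {g : ℝ → α}
    {F : Finset ℝ≥0} (hF : ∀ τ ∈ F, τ ∈ Set.Ioc 0 T ∧ jump x τ ≠ 0)
    (h : ∀ τ ∈ Set.Ioc 0 T, τ ∉ F → g (jump x τ) = 0) :
    (∑' t : {t : ℝ≥0 // 0 < t ∧ jump x t ≠ 0}, if t.1 ≤ T then g (jump x t.1) else 0) =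
      ∑ τ ∈ F, g (jump x τ) := by
  classical
  rw [tsum_eq_sum (s := F.subtype fun t => 0 < t ∧ jump x t ≠ 0)]
  · rw [Finset.sum_subtype_of_mem (p := fun t => 0 < t ∧ jump x t ≠ 0)
      (fun t => if t ≤ T then g (jump x t) else 0) fun τ hτ => ⟨(hF τ hτ).1.1, (hF τ hτ).2⟩]
    exact Finset.sum_congr rfl fun τ hτ => if_pos (hF τ hτ).1.2
  · intro t ht
    split_ifs with hT
    · exact h t.1 ⟨t.2.1, hT⟩ fun hm => ht (Finset.mem_subtype.2 hm)
    · rfl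

/-- A nonnegative sum over jumps is the supremum of its finite partial sums, each controlled by
`sum_jump_le_liminf`; no finiteness is assumed beforehand. -/
theorem IsCadlag.lintegral_jumpMeasure_le (hx : IsCadlag x) (hT : 0 < T) {g : ℝ → ℝ}
    (hg : ∀ y, 0 ≤ g y) (hgc : Continuous g) :
    ∫⁻ p in Set.Icc 0 T ×ˢ {0}ᶜ, ENNReal.ofReal (g p.2) ∂(jumpMeasure x) ≤
      liminf (fun n => ENNReal.ofReal (∑ k ∈ Finset.range n, g (gridIncr x T n k))) atTop := by
  classical
  rw [lintegral_jumpMeasure (g := fun y => ENNReal.ofReal (g y)) hgc.measurable.ennreal_ofReal,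
    ENNReal.tsum_eq_iSup_sum]
  refine iSup_le fun s => ?_
  let F : Finset ℝ≥0 := (s.filter fun t => t.1 ≤ T).map ⟨Subtype.val, Subtype.val_injective⟩
  refine le_trans (le_of_eq ?_) (hx.sum_jump_le_liminf hT hg hgc (F := F) ?_)
  · rw [ENNReal.ofReal_sum_of_nonneg fun _ _ => hg _, Finset.sum_map, Finset.sum_filter]
    rfl
  · intro τ hτ
    obtain ⟨t, ht, rfl⟩ := Finset.mem_map.1 hτ
    exact ⟨t.2.1, (Finset.mem_filter.1 ht).2⟩

/-- Pathwise convergence for integrands vanishing near `0`. -/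
theorem IsCadlag.integrableOn_and_tendsto (hx : IsCadlag x) (hT : 0 < T) {f : ℝ → ℝ}
    (hfm : Measurable f) {ε : ℝ} (hε : 0 < ε) (hf : ∀ y, |y| < ε → f y = 0)
    (hc : ∀ τ ∈ Set.Ioc 0 T, jump x τ ≠ 0 → ContinuousAt f (jump x τ)) :
    IntegrableOn (fun p : ℝ≥0 × ℝ => f p.2) (Set.Icc 0 T ×ˢ {0}ᶜ) (jumpMeasure x) ∧
    Tendsto (fun n => ∑ k ∈ Finset.range n, f (gridIncr x T n k)) atTop
      (𝓝 (∫ p in Set.Icc 0 T ×ˢ {0}ᶜ, f p.2 ∂(jumpMeasure x))) := by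
  have hfin := hx.finite_setOf_le_abs_jump T (half_pos hε)
  set F := hfin.toFinset with hFdef
  have hF : ∀ τ ∈ F, τ ∈ Set.Ioc 0 T ∧ jump x τ ≠ 0 := by
    intro τ hτ
    obtain ⟨h1, h2⟩ := (Set.Finite.mem_toFinset hfin).1 hτ
    exact ⟨h1, abs_pos.1 (by linarith)⟩
  have hFε : ∀ τ ∈ Set.Ioc 0 T, ε / 2 ≤ |jump x τ| → τ ∈ F := fun τ h1 h2 =>
    (Set.Finite.mem_toFinset hfin).2 ⟨h1, h2⟩
  have hzero : ∀ τ ∈ Set.Ioc 0 T, τ ∉ F → f (jump x τ) = 0 := by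
    intro τ h1 h2
    refine hf _ ?_
    by_contra hcon
    exact h2 (hFε τ h1 (by linarith))
  have hi : IntegrableOn (fun p : ℝ≥0 × ℝ => f p.2) (Set.Icc 0 T ×ˢ {0}ᶜ) (jumpMeasure x) := by
    refine ⟨(hfm.comp measurable_snd).aestronglyMeasurable, ?_⟩
    rw [HasFiniteIntegral, lintegral_jumpMeasure (g := fun y => ‖f y‖ₑ) hfm.enorm,
      tsum_jump_eq_sum (g := fun y => ‖f y‖ₑ) hF fun τ h1 h2 => by rw [hzero τ h1 h2, enorm_zero]]
    exact ENNReal.sum_lt_top.2 fun _ _ => enorm_lt_top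
  refine ⟨hi, ?_⟩
  rw [integral_jumpMeasure hi, tsum_jump_eq_sum hF hzero]
  exact hx.tendsto_sum_gridIncr hT hf (fun τ hτ => (hF τ hτ).1) hFε hε
    fun τ hτ => hc τ (hF τ hτ).1 (hF τ hτ).2

end JumpMeasure

/-- The truncation of `f` to the range `± δ (1 ∧ y²)`. -/
noncomputable def smallPart (f : ℝ → ℝ) (δ y : ℝ) : ℝ :=
  max (-(δ * min 1 (y ^ 2))) (min (f y) (δ * min 1 (y ^ 2)))

section SmallPart

variable {f : ℝ → ℝ} {δ : ℝ}

theorem abs_smallPart_le (hδ : 0 ≤ δ) (y : ℝ) : |smallPart f δ y| ≤ δ * min 1 (y ^ 2) := by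
  have h : 0 ≤ δ * min 1 (y ^ 2) := mul_nonneg hδ (min_one_sq_nonneg y)
  exact abs_le.2 ⟨le_max_left _ _, max_le (by linarith) (min_le_right _ _)⟩

theorem measurable_smallPart (hf : Measurable f) : Measurable (smallPart f δ) := by
  unfold smallPart; fun_prop

theorem continuousAt_smallPart {y : ℝ} (hf : ContinuousAt f y) :
    ContinuousAt (smallPart f δ) y := by
  unfold smallPart; fun_prop

/-- Near `0` the little-o condition already gives `|f(y)| ≤ δ y²`, so the truncation is inactive.
Clamping the values, unlike cutting off the argument, creates no new discontinuities. -/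
theorem exists_sub_smallPart_eq_zero (ho : f =o[𝓝 0] fun x : ℝ => x ^ 2) (hδ : 0 < δ) :
    ∃ ε > 0, ∀ y, |y| < ε → f y - smallPart f δ y = 0 := by
  obtain ⟨ε, hε, h⟩ := Metric.eventually_nhds_iff.1 (ho.bound hδ)
  refine ⟨min ε 1, lt_min hε one_pos, fun y hy => ?_⟩
  have h1 := h (y := y) (by simpa [Real.dist_eq] using hy.trans_le (min_le_left _ _))
  have h2 : |y| < 1 := hy.trans_le (min_le_right _ _)
  have h3 : y ^ 2 ≤ 1 := by nlinarith [sq_abs y, abs_nonneg y]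
  rw [norm_pow, Real.norm_eq_abs, Real.norm_eq_abs, sq_abs, abs_le] at h1
  rw [smallPart, min_eq_right h3, min_eq_left h1.2, max_eq_right h1.1, sub_self]

end SmallPart

end LevyDiscrete

/-! ### Statistics of the increments: factorisation and limits of means. -/

namespace LevyDiscrete

open Asymptotics

section Increments

variable {Ω : Type*} [MeasurableSpace Ω] {P : Measure Ω} [IsProbabilityMeasure P]
  {X : ℝ≥0 → Ω → ℝ} (hX : IsLevyProcess X P) {ν : Measure ℝ} {T : ℝ≥0}

omit [MeasurableSpace Ω] in
theorem discreteStat_eq (f : ℝ → ℝ) (n : ℕ) (ω : Ω) :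
    discreteStat X T f n ω = ∑ k ∈ Finset.range n, f (gridIncr (fun t => X t ω) T n k) := rfl

include hX

omit [IsProbabilityMeasure P] in
theorem IsLevyProcess.measurable_gridIncr (n k : ℕ) :
    Measurable fun ω => gridIncr (fun t => X t ω) T n k :=
  (hX.measurable _).sub (hX.measurable _)

omit [IsProbabilityMeasure P] in
theorem IsLevyProcess.measurable_discreteStat {f : ℝ → ℝ} (hf : Measurable f) (n : ℕ) :
    Measurable (discreteStat X T f n) := by
  have : discreteStat X T f n = fun ω =>
      ∑ k ∈ Finset.range n, f (gridIncr (fun t => X t ω) T n k) := rfl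
  rw [this]
  exact Finset.measurable_sum _ fun k _ => hf.comp (hX.measurable_gridIncr n k)

omit [IsProbabilityMeasure P] in
theorem IsLevyProcess.identDistrib_gridIncr (n k : ℕ) :
    IdentDistrib (fun ω => gridIncr (fun t => X t ω) T n k) (X (T / n)) P P := by
  have := hX.stationary (k * (T / n)) (T / n)
  rwa [show (k : ℝ≥0) * (T / n) + T / n = ((k : ℝ≥0) + 1) * (T / n) by ring] at this

omit [IsProbabilityMeasure P] in
theorem IsLevyProcess.lintegral_discreteStat {g : ℝ → ℝ} (hg : Measurable g) (hg0 : ∀ y, 0 ≤ g y)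
    (n : ℕ) : ∫⁻ ω, ENNReal.ofReal (discreteStat X T g n ω) ∂P =
      n * ∫⁻ y, ENNReal.ofReal (g y) ∂(P.map (X (T / n))) := by
  simp only [discreteStat_eq, ENNReal.ofReal_sum_of_nonneg fun _ _ => hg0 _]
  have hm : ∀ k, Measurable fun ω => ENNReal.ofReal (g (gridIncr (fun t => X t ω) T n k)) :=
    fun k => (hg.comp (hX.measurable_gridIncr n k)).ennreal_ofReal
  rw [lintegral_finsetSum _ fun k _ => hm k]
  have : ∀ k ∈ Finset.range n,
      ∫⁻ ω, ENNReal.ofReal (g (gridIncr (fun t => X t ω) T n k)) ∂P =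
        ∫⁻ y, ENNReal.ofReal (g y) ∂(P.map (X (T / n))) := fun k _ => by
    rw [lintegral_map hg.ennreal_ofReal (hX.measurable _)]
    exact ((hX.identDistrib_gridIncr n k).comp hg.ennreal_ofReal).lintegral_eq
  rw [Finset.sum_congr rfl this]
  simp

/-- Independence and stationarity of the increments factor the characteristic function of the
discrete statistic. -/
theorem IsLevyProcess.integral_exp_discreteStat {f : ℝ → ℝ} (hf : Measurable f) (u : ℝ) (n : ℕ) :
    ∫ ω, Complex.exp (Complex.I * u * discreteStat X T f n ω) ∂P =
      (1 + ∫ y, (Complex.exp (Complex.I * u * f y) - 1) ∂(P.map (X (T / n)))) ^ n := by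
  have hm : Measurable fun y : ℝ => Complex.exp (Complex.I * u * f y) := by fun_prop
  have hL := Measure.isProbabilityMeasure_map (μ := P) (hX.measurable (T / n)).aemeasurable
  have hi : Integrable (fun y : ℝ => Complex.exp (Complex.I * u * f y)) (P.map (X (T / n))) :=
    Integrable.of_bound hm.aestronglyMeasurable 1
      (ae_of_all _ fun y => (norm_exp_I_mul_real _ _).le)
  have hmono : Monotone fun i : Fin (n + 1) => (i : ℝ≥0) * (T / n) := fun i j hij => by
    have : (i : ℝ≥0) ≤ j := by exact_mod_cast hij
    dsimp only
    gcongr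
  have hind := hX.indep n _ hmono
  have hprod := hind.integral_fun_prod_comp
    (f := fun _ y => Complex.exp (Complex.I * u * f y))
    (fun i => ((hX.measurable _).sub (hX.measurable _)).aemeasurable)
    (fun i => hm.aestronglyMeasurable)
  have e : ∀ ω, Complex.exp (Complex.I * u * discreteStat X T f n ω) =
      ∏ i : Fin n, Complex.exp (Complex.I * u *
        f (X ((i.succ : ℕ) * (T / n)) ω - X ((i.castSucc : ℕ) * (T / n)) ω)) := by
    intro ω
    rw [discreteStat_eq, Finset.sum_range, Complex.ofReal_sum, Finset.mul_sum, Complex.exp_sum]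
    simp [gridIncr]
  simp only [e]
  refine hprod.trans ?_
  have hk : ∀ i : Fin n, ∫ ω, Complex.exp (Complex.I * u *
        f (X ((i.succ : ℕ) * (T / n)) ω - X ((i.castSucc : ℕ) * (T / n)) ω)) ∂P =
      1 + ∫ y, (Complex.exp (Complex.I * u * f y) - 1) ∂(P.map (X (T / n))) := by
    intro i
    rw [integral_sub hi (integrable_const _)]
    simp only [integral_const, probReal_univ, one_smul, add_sub_cancel]
    rw [integral_map (hX.measurable _).aemeasurable hm.aestronglyMeasurable]
    have := ((hX.identDistrib_gridIncr (T := T) n i).comp hm).integral_eq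
    simpa [gridIncr, Function.comp_def] using this
  rw [Finset.prod_congr rfl fun i _ => hk i]
  simp

end Increments

section Limits

variable {Ω : Type*} [MeasurableSpace Ω] {P : Measure Ω} [IsProbabilityMeasure P]
  {X : ℝ≥0 → Ω → ℝ} (hX : IsLevyProcess X P) {ν : Measure ℝ} (hν : HasLevyMeasure X P ν)
  {T : ℝ≥0} (hT : 0 < T)
include hX hν hT

omit [IsProbabilityMeasure P] in
/-- The laws `X(T/(n+1))` satisfy the hypotheses of the small-time limit theorems. -/
theorem HasLevyMeasure.exists_smallTime : ∃ b σ : ℝ,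
    (∀ n : ℕ, 0 < ((T / (n + 1 : ℕ) : ℝ≥0) : ℝ)) ∧
    Tendsto (fun n : ℕ => ((T / (n + 1 : ℕ) : ℝ≥0) : ℝ)) atTop (𝓝 0) ∧
    ∀ (n : ℕ) (u : ℝ), ∫ x, Complex.exp (Complex.I * u * x) ∂(P.map (X (T / (n + 1 : ℕ)))) =
      Complex.exp (((T / (n + 1 : ℕ) : ℝ≥0) : ℝ) * levyExponent b σ ν u) := by
  obtain ⟨-, b, σ, h⟩ := hν
  refine ⟨b, σ, fun n => ?_, ?_, fun n u => ?_⟩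
  · exact NNReal.coe_pos.2 (div_pos hT (by positivity))
  · exact NNReal.tendsto_coe.2 ((tendsto_mesh T).comp (tendsto_add_atTop_nat 1))
  · rw [integral_map (hX.measurable _).aemeasurable (by fun_prop)]
    exact h _ u

theorem tendsto_nat_mul_integral {g : ℝ → ℂ} (hg : Measurable g) {C : ℝ} (hC : ∀ x, ‖g x‖ ≤ C)
    (ho : g =o[𝓝 0] fun x : ℝ => x ^ 2) {D : Set ℝ} (hD : IsClosed D) (hD0 : (0 : ℝ) ∉ D)
    (hDν : ν D = 0) (hcont : ∀ x ∉ D, x ≠ 0 → ContinuousAt g x) :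
    Tendsto (fun n : ℕ => (n : ℂ) * ∫ x, g x ∂(P.map (X (T / n)))) atTop
      (𝓝 ((T : ℝ) * ∫ x, g x ∂ν)) := by
  obtain ⟨b, σ, ht, ht0, hL⟩ := hν.exists_smallTime hX hT
  have (n : ℕ) : IsProbabilityMeasure (P.map (X (T / (n + 1 : ℕ)))) :=
    Measure.isProbabilityMeasure_map (hX.measurable _).aemeasurable
  have h := (tendsto_inv_mul_integral hν.1 ht ht0 hL hg hC ho hD hD0 hDν hcont).const_mul
    ((T : ℝ) : ℂ)
  -- The index is shifted because `T / 0 = 0` would violate positivity of the times; then `T ·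
  -- (T/(n+1))⁻¹ = n + 1`.
  refine (tendsto_add_atTop_iff_nat 1).1 (h.congr fun n => ?_)
  have hT' : ((T : ℝ) : ℂ) ≠ 0 := by exact_mod_cast hT.ne'
  rw [← mul_assoc]
  congr 1
  push_cast
  field_simp

/-- Stated with the lower integral so that it combines directly with Fatou's lemma in `ae_jump_ne`.
-/
theorem tendsto_lintegral_discreteStat {g : ℝ → ℝ} (hg : Continuous g) (hg0 : ∀ y, 0 ≤ g y)
    {C : ℝ} (hC : ∀ x, ‖g x‖ ≤ C) (ho : g =o[𝓝 0] fun x : ℝ => x ^ 2) :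
    Tendsto (fun n : ℕ => ∫⁻ ω, ENNReal.ofReal (discreteStat X T g n ω) ∂P) atTop
      (𝓝 (ENNReal.ofReal (T * ∫ x, g x ∂ν))) := by
  obtain ⟨b, σ, ht, ht0, hL⟩ := hν.exists_smallTime hX hT
  have (n : ℕ) : IsProbabilityMeasure (P.map (X (T / (n + 1 : ℕ)))) :=
    Measure.isProbabilityMeasure_map (hX.measurable _).aemeasurable
  have h := (tendsto_inv_mul_integral_real hν.1 ht ht0 hL hg hC ho).const_mul (T : ℝ)
  refine (tendsto_add_atTop_iff_nat 1).1
    (((ENNReal.continuous_ofReal.tendsto _).comp h).congr fun n => ?_)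
  rw [hX.lintegral_discreteStat hg.measurable hg0, Function.comp_apply,
    ← ofReal_integral_eq_lintegral_ofReal _ (ae_of_all _ hg0), ← ENNReal.ofReal_natCast,
    ← ENNReal.ofReal_mul (by positivity), ← mul_assoc]
  · congr 2
    have hT' : (T : ℝ) ≠ 0 := by exact_mod_cast hT.ne'
    push_cast
    field_simp
  · exact Integrable.of_bound hg.aestronglyMeasurable C (ae_of_all _ hC)

theorem exists_lintegral_discreteStat_min_le :
    ∃ C : ℝ, 0 ≤ C ∧ ∀ n : ℕ,
      ∫⁻ ω, ENNReal.ofReal (discreteStat X T (fun y => min 1 (y ^ 2)) n ω) ∂P ≤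
        ENNReal.ofReal C := by
  obtain ⟨b, σ, ht, ht0, hL⟩ := hν.exists_smallTime hX hT
  have (n : ℕ) : IsProbabilityMeasure (P.map (X (T / (n + 1 : ℕ)))) :=
    Measure.isProbabilityMeasure_map (hX.measurable _).aemeasurable
  obtain ⟨C, hC⟩ := exists_inv_mul_integral_min_le hν.1 ht ht0 hL
  refine ⟨T * max C 0, by positivity, fun n => ?_⟩
  rcases n with _ | n
  · simp [discreteStat]
  rw [hX.lintegral_discreteStat measurable_min_one_sq min_one_sq_nonneg,
    ← ofReal_integral_eq_lintegral_ofReal _ (ae_of_all _ min_one_sq_nonneg),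
    ← ENNReal.ofReal_natCast, ← ENNReal.ofReal_mul (by positivity)]
  · refine ENNReal.ofReal_le_ofReal ?_
    have h := mul_le_mul_of_nonneg_left ((hC n).trans (le_max_left C 0)) T.coe_nonneg
    refine le_trans (le_of_eq ?_) h
    rw [← mul_assoc]
    congr 1
    have hT' : (T : ℝ) ≠ 0 := by exact_mod_cast hT.ne'
    push_cast
    field_simp
  · exact Integrable.of_bound measurable_min_one_sq.aestronglyMeasurable 1 (ae_of_all _ fun x => by
      rw [Real.norm_of_nonneg (min_one_sq_nonneg x)]; exact min_le_left _ _)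

end Limits

end LevyDiscrete

/-! ### Sizes that jumps avoid, integrability over the jumps, and convergence in probability. -/

namespace LevyDiscrete

open Asymptotics

/-- The tent function of height `1` at `d` and half-width `1 / j`. -/
noncomputable def tent (d : ℝ) (j : ℕ) (y : ℝ) : ℝ := max 0 (1 - j * |y - d|)

theorem continuous_tent (d : ℝ) (j : ℕ) : Continuous (tent d j) := by
  unfold tent; fun_prop

theorem tent_nonneg (d : ℝ) (j : ℕ) (y : ℝ) : 0 ≤ tent d j y := le_max_left _ _

theorem norm_tent_le (d : ℝ) (j : ℕ) (y : ℝ) : ‖tent d j y‖ ≤ 1 := by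
  rw [Real.norm_of_nonneg (tent_nonneg d j y)]
  exact max_le zero_le_one (by
    nlinarith [mul_nonneg (Nat.cast_nonneg (α := ℝ) j) (abs_nonneg (y - d))])

theorem tent_self (d : ℝ) (j : ℕ) : tent d j d = 1 := by simp [tent]

theorem tent_antitone (d y : ℝ) : Antitone fun j => tent d j y := fun i j hij => by
  unfold tent
  have : (i : ℝ) ≤ j := by exact_mod_cast hij
  dsimp only
  gcongr

theorem tent_isLittleO {d : ℝ} {j : ℕ} (hj : 1 < j * |d|) :
    tent d j =o[𝓝 0] fun x : ℝ => x ^ 2 := by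
  have h : ∀ᶠ y in 𝓝 (0 : ℝ), 1 < j * |y - d| := by
    have hc : Continuous fun y : ℝ => (j : ℝ) * |y - d| := by fun_prop
    exact hc.continuousAt.eventually (lt_mem_nhds (by simpa using hj))
  refine (isLittleO_zero _ _).congr' ?_ EventuallyEq.rfl
  filter_upwards [h] with y hy
  exact (max_eq_left (by linarith)).symm

theorem tendsto_tent {d y : ℝ} (hy : y ≠ d) : Tendsto (fun j => tent d j y) atTop (𝓝 0) := by
  have h : Tendsto (fun j : ℕ => (j : ℝ) * |y - d|) atTop atTop :=
    tendsto_natCast_atTop_atTop.atTop_mul_const (abs_pos.2 (sub_ne_zero.2 hy))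
  refine tendsto_const_nhds.congr' ?_
  filter_upwards [h.eventually_ge_atTop 1] with j hj
  exact (max_eq_left (by linarith)).symm

section Limits

variable {Ω : Type*} [MeasurableSpace Ω] {P : Measure Ω} [IsProbabilityMeasure P]
  {X : ℝ≥0 → Ω → ℝ} (hX : IsLevyProcess X P) {ν : Measure ℝ} (hν : HasLevyMeasure X P ν)
  {T : ℝ≥0} (hT : 0 < T)
include hX hν hT

/-- A size that is not an atom of the Lévy measure is almost surely not the size of a jump. -/
theorem ae_jump_ne {d : ℝ} (hd : d ≠ 0) (hνd : ν {d} = 0) :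
    ∀ᵐ ω ∂P, ∀ τ ∈ Set.Ioc 0 T, jump (fun t => X t ω) τ ≠ d := by
  -- Beyond `j₀` the tents around `d` vanish near `0`, so they are admissible test functions.
  obtain ⟨j₀, hj₀⟩ := exists_nat_gt (1 / |d|)
  have hd' : 0 < |d| := abs_pos.2 hd
  rw [div_lt_iff₀ hd'] at hj₀
  have hj : ∀ n : ℕ, 1 < ((n + j₀ : ℕ) : ℝ) * |d| := fun n => by
    push_cast
    nlinarith [mul_nonneg (Nat.cast_nonneg (α := ℝ) n) hd'.le]
  set A := {ω | ¬ ∀ τ ∈ Set.Ioc 0 T, jump (fun t => X t ω) τ ≠ d}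
  -- A jump of size `d` forces the liminf of the tent statistics to be at least `1`. Markov, Fatou
  -- and the limit of the means then bound the probability.
  have hbound : ∀ n : ℕ, P A ≤ ENNReal.ofReal (T * ∫ y, tent d (n + j₀) y ∂ν) := by
    intro n
    set g := tent d (n + j₀)
    have hm : ∀ k : ℕ, Measurable fun ω => ENNReal.ofReal (discreteStat X T g k ω) := fun k =>
      (hX.measurable_discreteStat (continuous_tent _ _).measurable k).ennreal_ofReal
    have hsub : A ≤ᵐ[P]
        {ω | 1 ≤ liminf (fun k => ENNReal.ofReal (discreteStat X T g k ω)) atTop} := by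
      filter_upwards [hX.cadlag] with ω hω hA
      obtain ⟨τ, hτ, hj⟩ : ∃ τ ∈ Set.Ioc 0 T, jump (fun t => X t ω) τ = d := by
        have hA' : ¬ ∀ τ ∈ Set.Ioc 0 T, jump (fun t => X t ω) τ ≠ d := hA
        push Not at hA'
        exact hA'
      have := hω.sum_jump_le_liminf hT (tent_nonneg d (n + j₀)) (continuous_tent _ _)
        (F := {τ}) (by simpa using hτ)
      rw [Finset.sum_singleton, hj, tent_self, ENNReal.ofReal_one] at this
      exact this
    calc P A ≤ P {ω | 1 ≤ liminf (fun k => ENNReal.ofReal (discreteStat X T g k ω)) atTop} :=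
          measure_mono_ae hsub
      _ ≤ ∫⁻ ω, liminf (fun k => ENNReal.ofReal (discreteStat X T g k ω)) atTop ∂P := by
          simpa using mul_meas_ge_le_lintegral (μ := P) (Measurable.liminf hm) 1
      _ ≤ liminf (fun k => ∫⁻ ω, ENNReal.ofReal (discreteStat X T g k ω) ∂P) atTop :=
          lintegral_liminf_le hm
      _ = _ := (tendsto_lintegral_discreteStat hX hν hT (continuous_tent _ _) (tent_nonneg _ _)
          (norm_tent_le _ _) (tent_isLittleO (hj n))).liminf_eq
  have h_integrable : ∀ n, Integrable (tent d (n + j₀)) ν := fun n => by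
    obtain ⟨K, -, hK⟩ := exists_norm_le_mul_min (norm_tent_le d (n + j₀)) (tent_isLittleO (hj n))
    exact hν.1.integrable_of_le (continuous_tent _ _).aestronglyMeasurable hK
  -- The tents decrease to the indicator of `{d}`, which is `ν`-null.
  have hlim : Tendsto (fun n => ∫ y, tent d (n + j₀) y ∂ν) atTop (𝓝 (∫ _, (0 : ℝ) ∂ν)) := by
    refine tendsto_integral_of_dominated_convergence (tent d (0 + j₀))
      (fun n => (continuous_tent _ _).aestronglyMeasurable) (h_integrable 0) (fun n => ?_) ?_
    · refine ae_of_all _ fun y => ?_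
      rw [Real.norm_of_nonneg (tent_nonneg _ _ _)]
      exact tent_antitone d y (by omega)
    · have : ∀ᵐ y ∂ν, y ≠ d := by rw [ae_iff]; simpa using hνd
      filter_upwards [this] with y hy
      exact (tendsto_tent hy).comp (tendsto_add_atTop_nat j₀)
  rw [integral_zero] at hlim
  have hlim' : Tendsto (fun n => ENNReal.ofReal (T * ∫ y, tent d (n + j₀) y ∂ν)) atTop (𝓝 0) := by
    have := (ENNReal.continuous_ofReal.tendsto _).comp (hlim.const_mul (T : ℝ))
    simpa only [mul_zero, ENNReal.ofReal_zero, Function.comp_def] using this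
  exact le_antisymm (ge_of_tendsto' hlim' hbound) zero_le

/-- The jumps up to time `T` have an almost surely finite sum of `1 ∧ |ΔX|²`, bounded by a random
variable with finite mean. -/
theorem exists_lintegral_jump_le : ∃ (C : ℝ) (S : Ω → ℝ≥0∞), 0 ≤ C ∧ Measurable S ∧
    (∫⁻ ω, S ω ∂P ≤ ENNReal.ofReal C) ∧
    (∀ n : ℕ, ∫⁻ ω, ENNReal.ofReal (discreteStat X T (fun y => min 1 (y ^ 2)) n ω) ∂P ≤
        ENNReal.ofReal C) ∧
    ∀ᵐ ω ∂P, ∫⁻ p in Set.Icc 0 T ×ˢ {0}ᶜ, ENNReal.ofReal (min 1 (p.2 ^ 2))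
      ∂(jumpMeasure fun t => X t ω) ≤ S ω := by
  obtain ⟨C, hC0, hC⟩ := exists_lintegral_discreteStat_min_le hX hν hT
  have hm : ∀ k : ℕ, Measurable fun ω =>
      ENNReal.ofReal (discreteStat X T (fun y => min 1 (y ^ 2)) k ω) := fun k =>
    (hX.measurable_discreteStat measurable_min_one_sq k).ennreal_ofReal
  -- A liminf of measurable statistics is measurable, so Markov's inequality can be applied to `S`
  -- without knowing that the jump integral is measurable in `ω`.
  refine ⟨C, fun ω => liminf (fun k =>
    ENNReal.ofReal (discreteStat X T (fun y => min 1 (y ^ 2)) k ω)) atTop, hC0,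
    Measurable.liminf hm, ?_, hC, ?_⟩
  · refine (lintegral_liminf_le hm).trans ?_
    exact (liminf_le_liminf (Eventually.of_forall hC)).trans_eq (liminf_const _)
  · filter_upwards [hX.cadlag] with ω hω
    simp only [discreteStat_eq]
    exact hω.lintegral_jumpMeasure_le (g := fun y => min 1 (y ^ 2)) hT min_one_sq_nonneg
      (by fun_prop)

omit hX hν hT [IsProbabilityMeasure P] [MeasurableSpace Ω] in
theorem lintegral_smallPart_le (f : ℝ → ℝ) {δ : ℝ} (hδ : 0 ≤ δ) (ω : Ω) :
    ∫⁻ p in Set.Icc 0 T ×ˢ {0}ᶜ, ‖smallPart f δ p.2‖ₑ ∂(jumpMeasure fun t => X t ω) ≤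
      ENNReal.ofReal δ * ∫⁻ p in Set.Icc 0 T ×ˢ {0}ᶜ, ENNReal.ofReal (min 1 (p.2 ^ 2))
        ∂(jumpMeasure fun t => X t ω) := by
  have hm : Measurable fun p : ℝ≥0 × ℝ => ENNReal.ofReal (min 1 (p.2 ^ 2)) :=
    (measurable_min_one_sq.comp measurable_snd).ennreal_ofReal
  rw [← lintegral_const_mul _ hm]
  refine lintegral_mono fun p => ?_
  rw [← ENNReal.ofReal_mul hδ, Real.enorm_eq_ofReal_abs]
  exact ENNReal.ofReal_le_ofReal (abs_smallPart_le hδ _)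

theorem ae_integrableOn_smallPart {f : ℝ → ℝ} (hf : Measurable f) {δ : ℝ} (hδ : 0 < δ) : ∀ᵐ ω ∂P,
    IntegrableOn (fun p : ℝ≥0 × ℝ => smallPart f δ p.2) (Set.Icc 0 T ×ˢ {0}ᶜ)
      (jumpMeasure fun t => X t ω) := by
  obtain ⟨C, S, hC0, hSm, hS, -, hN⟩ := exists_lintegral_jump_le hX hν hT
  have hfin : ∀ᵐ ω ∂P, S ω < ∞ := ae_lt_top hSm (hS.trans_lt ENNReal.ofReal_lt_top).ne
  filter_upwards [hN, hfin] with ω h1 h2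
  refine ⟨((measurable_smallPart hf).comp measurable_snd).aestronglyMeasurable, ?_⟩
  exact (lintegral_smallPart_le f hδ.le ω).trans_lt
    (ENNReal.mul_lt_top ENNReal.ofReal_lt_top (h1.trans_lt h2))

section Integrand

variable {f : ℝ → ℝ} (hf : Measurable f) (ho : f =o[𝓝 0] fun x : ℝ => x ^ 2) {D : Set ℝ}
  (hD : D.Finite) (hD0 : (0 : ℝ) ∉ D) (hDν : ν D = 0)
  (hcont : ∀ x ∉ D, x ≠ 0 → ContinuousAt f x)
include hf ho hD hD0 hDν hcont

theorem ae_integrableOn_and_tendsto_sub_smallPart {δ : ℝ} (hδ : 0 < δ) : ∀ᵐ ω ∂P,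
    IntegrableOn (fun p : ℝ≥0 × ℝ => f p.2 - smallPart f δ p.2) (Set.Icc 0 T ×ˢ {0}ᶜ)
      (jumpMeasure fun t => X t ω) ∧
    Tendsto (fun n => discreteStat X T (fun y => f y - smallPart f δ y) n ω) atTop
      (𝓝 (poissonIntegral X T (fun y => f y - smallPart f δ y) ω)) := by
  have hjump : ∀ᵐ ω ∂P, ∀ d ∈ D, ∀ τ ∈ Set.Ioc 0 T, jump (fun t => X t ω) τ ≠ d :=
    (ae_ball_iff hD.countable).2 fun d hd => ae_jump_ne hX hν hT (fun h => hD0 (h ▸ hd))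
      (measure_mono_null (Set.singleton_subset_iff.2 hd) hDν)
  obtain ⟨ε, hε, hz⟩ := exists_sub_smallPart_eq_zero ho hδ
  filter_upwards [hX.cadlag, hjump] with ω hω hJ
  refine hω.integrableOn_and_tendsto hT (hf.sub (measurable_smallPart hf)) hε hz fun τ hτ h0 => ?_
  have := hcont (jump (fun t => X t ω) τ) (fun hm => hJ _ hm τ hτ rfl) h0
  exact this.sub (continuousAt_smallPart this)

theorem ae_integrableOn_jumpMeasure : ∀ᵐ ω ∂P,
    IntegrableOn (fun p : ℝ≥0 × ℝ => f p.2) (Set.Icc 0 T ×ˢ {0}ᶜ)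
      (jumpMeasure fun t => X t ω) := by
  filter_upwards [ae_integrableOn_smallPart hX hν hT hf one_pos,
    ae_integrableOn_and_tendsto_sub_smallPart hX hν hT hf ho hD hD0 hDν hcont one_pos]
    with ω h1 h2
  simpa [Pi.add_def] using h2.1.add h1

/-- With `f = f₁ + smallPart f δ`, the error splits into three: the `f₁` error, which vanishes
almost surely, and the grid and jump sums of the small part, both bounded in mean by `δ C`. -/
theorem tendstoInMeasure_discreteStat :
    TendstoInMeasure P (fun n => discreteStat X T f n) atTop (poissonIntegral X T f) := by
  obtain ⟨C, S, hC0, hSm, hS, hCn, hN⟩ := exists_lintegral_jump_le hX hν hT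
  rw [tendstoInMeasure_iff_dist]
  intro η hη
  rw [ENNReal.tendsto_nhds_zero]
  intro κ' hκ'
  obtain ⟨κ, hκ0, hκle⟩ : ∃ κ : ℝ, 0 < κ ∧ ENNReal.ofReal κ ≤ κ' := by
    obtain ⟨r, hr0, hr⟩ := ENNReal.lt_iff_exists_nnreal_btwn.1 hκ'
    exact ⟨r, by exact_mod_cast hr0, by simpa using hr.le⟩
  -- Chosen so that Markov at level `η/3` gives probability at most `κ/3`; `C + 1` avoids division
  -- by zero.
  set δ := κ * η / (9 * (C + 1)) with hδdef
  have hδ : 0 < δ := by positivity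
  have hδC : δ * C / (η / 3) ≤ κ / 3 := by
    rw [div_le_iff₀ (by positivity)]
    have : δ * (C + 1) = κ * η / 9 := by rw [hδdef]; field_simp
    nlinarith
  set f₁ := fun y => f y - smallPart f δ y with hf₁
  have hf₁m : Measurable f₁ := hf.sub (measurable_smallPart hf)
  have hI := ae_integrableOn_and_tendsto_sub_smallPart hX hν hT hf ho hD hD0 hDν hcont hδ
  have hR := ae_integrableOn_smallPart hX hν hT hf hδ
  have hmeas : TendstoInMeasure P (fun n => discreteStat X T f₁ n) atTop
      (poissonIntegral X T f₁) :=
    tendstoInMeasure_of_tendsto_ae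
      (fun n => (hX.measurable_discreteStat hf₁m n).aestronglyMeasurable)
      (hI.mono fun ω h => h.2)
  have hev := (ENNReal.tendsto_nhds_zero.1
    (tendstoInMeasure_iff_dist.1 hmeas (η / 3) (by positivity))) (ENNReal.ofReal (κ / 3))
    (ENNReal.ofReal_pos.2 (by positivity))
  have markov : ∀ G : Ω → ℝ≥0∞, Measurable G → ∫⁻ ω, G ω ∂P ≤ ENNReal.ofReal C →
      P {ω | ENNReal.ofReal (η / 3) ≤ ENNReal.ofReal δ * G ω} ≤ ENNReal.ofReal (κ / 3) := by
    intro G hG hGC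
    have hp : ENNReal.ofReal (η / 3) ≠ 0 := (ENNReal.ofReal_pos.2 (by positivity)).ne'
    refine (meas_ge_le_lintegral_div (hG.const_mul _).aemeasurable hp
      ENNReal.ofReal_ne_top).trans ?_
    rw [lintegral_const_mul _ hG]
    calc (ENNReal.ofReal δ * ∫⁻ ω, G ω ∂P) / ENNReal.ofReal (η / 3)
        ≤ ENNReal.ofReal δ * ENNReal.ofReal C / ENNReal.ofReal (η / 3) := by gcongr
      _ = ENNReal.ofReal (δ * C / (η / 3)) := by
          rw [← ENNReal.ofReal_mul hδ.le,
            ENNReal.ofReal_div_of_pos (y := η / 3) (by positivity)]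
      _ ≤ _ := ENNReal.ofReal_le_ofReal hδC
  filter_upwards [hev] with n hn
  set m := fun y : ℝ => min 1 (y ^ 2) with hmdef
  have hsub : {ω | η ≤ dist (discreteStat X T f n ω) (poissonIntegral X T f ω)} ≤ᵐ[P]
      (({ω | η / 3 ≤ dist (discreteStat X T f₁ n ω) (poissonIntegral X T f₁ ω)} ∪
        {ω | ENNReal.ofReal (η / 3) ≤
          ENNReal.ofReal δ * ENNReal.ofReal (discreteStat X T m n ω)}) ∪
        {ω | ENNReal.ofReal (η / 3) ≤ ENNReal.ofReal δ * S ω} : Set Ω) := by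
    filter_upwards [hI, hR, hN] with ω h1 h2 h3 hω
    by_contra hcon
    have hcon' : ¬ ((η / 3 ≤ dist (discreteStat X T f₁ n ω) (poissonIntegral X T f₁ ω) ∨
        ENNReal.ofReal (η / 3) ≤ ENNReal.ofReal δ * ENNReal.ofReal (discreteStat X T m n ω)) ∨
        ENNReal.ofReal (η / 3) ≤ ENNReal.ofReal δ * S ω) := hcon
    push Not at hcon'
    obtain ⟨⟨c1, c2⟩, c3⟩ := hcon'
    have hη' : η ≤ dist (discreteStat X T f n ω) (poissonIntegral X T f ω) := hω
    have e1 : discreteStat X T f n ω =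
        discreteStat X T f₁ n ω + discreteStat X T (smallPart f δ) n ω := by
      simp only [discreteStat_eq, ← Finset.sum_add_distrib, hf₁, sub_add_cancel]
    have e2 : poissonIntegral X T f ω =
        poissonIntegral X T f₁ ω + poissonIntegral X T (smallPart f δ) ω := by
      simp only [poissonIntegral]
      rw [← integral_add h1.1 h2]
      simp only [sub_add_cancel]
    have b1 : |discreteStat X T (smallPart f δ) n ω| < η / 3 := by
      have : |discreteStat X T (smallPart f δ) n ω| ≤ δ * discreteStat X T m n ω := by
        simp only [discreteStat_eq, Finset.mul_sum]
        exact (Finset.abs_sum_le_sum_abs _ _).trans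
          (Finset.sum_le_sum fun k _ => abs_smallPart_le hδ.le _)
      refine this.trans_lt ?_
      rw [← ENNReal.ofReal_mul hδ.le] at c2
      exact (ENNReal.ofReal_lt_ofReal_iff (by positivity)).1 c2
    have b2 : |poissonIntegral X T (smallPart f δ) ω| < η / 3 := by
      have h4 : ‖poissonIntegral X T (smallPart f δ) ω‖ₑ < ENNReal.ofReal (η / 3) := by
        refine (enorm_integral_le_lintegral_enorm _).trans_lt ?_
        refine (lintegral_smallPart_le f hδ.le ω).trans_lt (lt_of_le_of_lt ?_ c3)
        gcongr
      rw [Real.enorm_eq_ofReal_abs] at h4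
      exact (ENNReal.ofReal_lt_ofReal_iff (by positivity)).1 h4
    rw [e1, e2, Real.dist_eq] at hη'
    rw [Real.dist_eq, abs_lt] at c1
    rw [abs_lt] at b1 b2
    have : |discreteStat X T f₁ n ω + discreteStat X T (smallPart f δ) n ω -
        (poissonIntegral X T f₁ ω + poissonIntegral X T (smallPart f δ) ω)| < η := by
      rw [abs_lt]
      constructor <;> linarith [c1.1, c1.2, b1.1, b1.2, b2.1, b2.2]
    linarith
  refine (measure_mono_ae hsub).trans ((measure_union_le _ _).trans ?_)
  refine (add_le_add (measure_union_le _ _) le_rfl).trans ?_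
  have k1 := markov _ (hX.measurable_discreteStat measurable_min_one_sq n).ennreal_ofReal (hCn n)
  have k2 := markov S hSm hS
  refine (add_le_add (add_le_add hn k1) k2).trans (le_trans (le_of_eq ?_) hκle)
  rw [← ENNReal.ofReal_add (by positivity) (by positivity),
    ← ENNReal.ofReal_add (by positivity) (by positivity)]
  congr 1
  ring

theorem tendstoInDistribution_discreteStat :
    TendstoInDistribution (fun n : ℕ => discreteStat X T f n) atTop
      (poissonIntegral X T f) (fun _ => P) P := by
  have h := tendstoInMeasure_discreteStat hX hν hT hf ho hD hD0 hDν hcont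
  have hm : ∀ n, AEMeasurable (discreteStat X T f n) P := fun n =>
    (hX.measurable_discreteStat hf n).aemeasurable
  exact h.tendstoInDistribution hm

/-- By `|e^{iy} - 1| ≤ |y|`, the function `e^{iuf} - 1` inherits `o(x²)` from `f`, and it is bounded
by `2` even when `f` is unbounded, so the small-time limit applies. -/
theorem integrableOn_and_tendsto_integral_exp (u : ℝ) :
    IntegrableOn (fun x : ℝ => Complex.exp (Complex.I * u * f x) - 1) {0}ᶜ ν ∧
    Tendsto (fun n : ℕ => ∫ ω, Complex.exp (Complex.I * u * discreteStat X T f n ω) ∂P) atTop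
      (𝓝 (Complex.exp ((T : ℝ) * ∫ x in {0}ᶜ, (Complex.exp (Complex.I * u * f x) - 1) ∂ν))) := by
  set g : ℝ → ℂ := fun x => Complex.exp (Complex.I * u * f x) - 1 with hg
  have hgm : Measurable g := by fun_prop
  have hgb : ∀ x, ‖g x‖ ≤ 2 := fun x => by
    refine (norm_sub_le _ _).trans ?_
    rw [norm_exp_I_mul_real, norm_one]
    norm_num
  have hgo : g =o[𝓝 0] fun x : ℝ => x ^ 2 := by
    refine IsBigO.trans_isLittleO (g := f)
      (IsBigO.of_bound |u| (Eventually.of_forall fun x => ?_)) ho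
    have := Real.norm_exp_I_mul_ofReal_sub_one_le (x := u * f x)
    rw [norm_mul, Complex.ofReal_mul, ← mul_assoc] at this
    exact this
  have hgc : ∀ x ∉ D, x ≠ 0 → ContinuousAt g x := fun x hx h0 => by
    have := hcont x hx h0
    fun_prop
  rw [IntegrableOn, hν.1.restrict_compl_zero]
  refine ⟨?_, ?_⟩
  · obtain ⟨K, -, hK⟩ := exists_norm_le_mul_min hgb hgo
    exact hν.1.integrable_of_le hgm.aestronglyMeasurable hK
  · simp only [hX.integral_exp_discreteStat hf]
    exact Complex.tendsto_one_add_pow_exp_of_tendsto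
      (tendsto_nat_mul_integral hX hν hT hgm hgb hgo hD.isClosed hD0 hDν hgc)

end Integrand

end Limits

/-! ### Reduction of the two kinds of integrands to common hypotheses. -/

/-- Both kinds of integrands are measurable, `o(x²)` at `0`, and continuous off `0` and a finite
`ν`-null set. -/
theorem exists_finite_discontinuities {ν : Measure ℝ} {f : ℝ → ℝ}
    (hf : IsWindowed ν f ∨ IsSmallAtZero f) :
    Measurable f ∧ (f =o[𝓝 0] fun x : ℝ => x ^ 2) ∧ ∃ D : Set ℝ, D.Finite ∧ (0 : ℝ) ∉ D ∧
      ν D = 0 ∧ ∀ x ∉ D, x ≠ 0 → ContinuousAt f x := by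
  rcases hf with ⟨a, b, h, hab, hsub, ha, hb, hc, rfl⟩ | ⟨h0, hc, hl⟩
  -- Outside `[a, b]` nothing is known about `h`, not even measurability, so it is replaced by its
  -- continuous constant extension.
  · set H := Set.IccExtend hab ((Set.Icc a b).domRestrict h)
    have hHc : Continuous H := (continuousOn_iff_continuous_domRestrict.1 hc).Icc_extend'
    have e : (Set.Ioc a b).indicator h = (Set.Ioc a b).indicator H := by
      refine Set.indicator_congr fun x hx => ?_
      exact (Set.IccExtend_of_mem hab ((Set.Icc a b).domRestrict h)
        (Set.Ioc_subset_Icc_self hx)).symm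
    have hout : ∀ x ∉ Set.Icc a b, (Set.Ioc a b).indicator h =ᶠ[𝓝 x] 0 := fun x hx => by
      filter_upwards [isClosed_Icc.isOpen_compl.mem_nhds hx] with y hy
      exact Set.indicator_of_notMem (fun hm => hy (Set.Ioc_subset_Icc_self hm)) _
    have h0 : (0 : ℝ) ∉ Set.Icc a b := fun hm => hsub hm rfl
    refine ⟨?_, ?_, {a, b}, by simp, ?_, ?_, fun x hx _ => ?_⟩
    · rw [e]
      exact hHc.measurable.indicator measurableSet_Ioc
    · exact (isLittleO_zero _ _).congr' (hout 0 h0).symm EventuallyEq.rfl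
    · rintro (rfl | h)
      · exact h0 (Set.left_mem_Icc.2 hab)
      · obtain rfl : (0 : ℝ) = b := h
        exact h0 (Set.right_mem_Icc.2 hab)
    · exact measure_union_null ha hb
    · simp only [Set.mem_insert_iff, Set.mem_singleton_iff, not_or] at hx
      by_cases hm : x ∈ Set.Icc a b
      · have hm' : Set.Ioo a b ∈ 𝓝 x :=
          Ioo_mem_nhds (lt_of_le_of_ne hm.1 (Ne.symm hx.1)) (lt_of_le_of_ne hm.2 hx.2)
        refine hHc.continuousAt.congr ?_
        rw [e]
        filter_upwards [hm'] with y hy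
        exact (Set.indicator_of_mem (Set.Ioo_subset_Ioc_self hy) _).symm
      · exact (continuousAt_const (y := (0 : ℝ))).congr (hout x hm).symm
  · refine ⟨measurable_of_continuousOn_compl_singleton 0 hc, ?_, ∅, Set.finite_empty, by simp,
      by simp, fun x _ hx => hc.continuousAt (isOpen_compl_singleton.mem_nhds hx)⟩
    refine isLittleO_iff.2 fun c hc0 => ?_
    have h1 := eventually_nhdsWithin_iff.1 (Metric.tendsto_nhds.1 hl c hc0)
    filter_upwards [h1] with x hx
    -- The little-o relation is over full neighbourhoods of `0`, so the convention `f 0 = 0` is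
    -- needed.
    by_cases hx0 : x = 0
    · simp [hx0, h0]
    · have h2 := hx hx0
      rw [dist_zero_right, norm_div, norm_pow, Real.norm_eq_abs |x|, abs_abs, ← Real.norm_eq_abs x,
        div_lt_iff₀ (by positivity)] at h2
      rw [norm_pow]
      exact h2.le

end LevyDiscrete

theorem proposition6p2 {Ω : Type*} [MeasurableSpace Ω] (P : Measure Ω) [IsProbabilityMeasure P]
    (X : ℝ≥0 → Ω → ℝ) (hX : LevyDiscrete.IsLevyProcess X P)
    (ν : Measure ℝ) (hν : LevyDiscrete.HasLevyMeasure X P ν)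
    (T : ℝ≥0) (hT : 0 < T) (f : ℝ → ℝ)
    (hf : LevyDiscrete.IsWindowed ν f ∨ LevyDiscrete.IsSmallAtZero f) :
    (∀ u : ℝ,
      IntegrableOn (fun x : ℝ => Complex.exp (Complex.I * u * f x) - 1) {0}ᶜ ν ∧
      Tendsto
        (fun n : ℕ => ∫ ω, Complex.exp (Complex.I * u * LevyDiscrete.discreteStat X T f n ω) ∂P)
        atTop
        (𝓝 (Complex.exp ((T : ℝ) *
          ∫ x in {0}ᶜ, (Complex.exp (Complex.I * u * f x) - 1) ∂ν)))) ∧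
    (∀ᵐ ω ∂P, IntegrableOn (fun p : ℝ≥0 × ℝ => f p.2) (Set.Icc 0 T ×ˢ {0}ᶜ)
      (LevyDiscrete.jumpMeasure fun t => X t ω)) ∧
    TendstoInDistribution (fun n : ℕ => LevyDiscrete.discreteStat X T f n) atTop
      (LevyDiscrete.poissonIntegral X T f) (fun _ => P) P := by
  obtain ⟨hm, ho, D, hD, hD0, hDν, hcont⟩ := LevyDiscrete.exists_finite_discontinuities hf
  exact ⟨LevyDiscrete.integrableOn_and_tendsto_integral_exp hX hν hT hm ho hD hD0 hDν hcont,
    LevyDiscrete.ae_integrableOn_jumpMeasure hX hν hT hm ho hD hD0 hDν hcont,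
    LevyDiscrete.tendstoInDistribution_discreteStat hX hν hT hm ho hD hD0 hDν hcont⟩
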